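/- Throughout, $n\ge 2$, $B(x,r)$ is the closed ball in $\mathbb R^n$, $B_s=B(0,s)$, and $\mathrm{HD}$ is the Hausdorff distance. For a nonempty class $\mathcal S$ of closed sets containing $0$, a set $A\subset\mathbb R^n$, $x\in A$ and $r>0$ put $$\Theta^{\mathcal S}_A(x,r)=\frac1r\inf_{V\in\mathcal S}\mathrm{HD}\big[A\cap B(x,r),(x+V)\cap B(x,r)\big].$$ Say that $A$ is *locally well-approximated by* $\mathcal S$ if for every $\delta>0$ and every compact $K\subset A$ there is $r_0>0$ with $\Theta^{\mathcal S}_A(x,r)\le\delta$ for all $x\in K$ and $0<r\le r_0$. Let $\mathcal H_d$ be the class of zero sets of nonconstant harmonic polynomials $h:\mathbb R^n\to\mathbb R$ of degree at most $d$ with $h(0)=0$, and let $\mathcal F=G(n,n-1)$ be the class of hyperplanes through the origin. $A$ is *locally Reifenberg flat with vanishing constant* if it is locally well-approximated by $\mathcal F$, and $x\in A$ is a *flat point* of $A$ if $\Theta^{\mathcal F}_A(x,r)\to0$ as $r\downarrow0$. A *blow-up* of a closed set $\Gamma$ centered at $x\in\Gamma$ is a closed set $B$ such that for some sequence $r_i\downarrow0$,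 $\mathrm{HD}\big[\tfrac{\Gamma-x}{r_i}\cap B_s,\,B\cap B_s\big]\to0$ for every $s>0$. **Theorem.** Let $\Gamma\subset\mathbb R^n$ be a nonempty closed set that is locally well-approximated by $\mathcal H_d$ for some $d\ge1$, and suppose that every blow-up of $\Gamma$ (centered at any point of $\Gamma$) is the zero set of a nonconstant homogeneous harmonic polynomial. Then $\Gamma$ is a disjoint union $\Gamma=\Gamma_1\cup\Gamma_s$, where $\Gamma_1$ is the set of flat points of $\Gamma$, with the following properties. 1. Every blow-up of $\Gamma$ centered at a point of $\Gamma_1$ is a hyperplane through the origin. 2. Every blow-up of $\Gamma$ centered at a point of $\Gamma_s$ is the zero set of a nonzero homogeneous harmonic polynomial of degree at least $2$. 3. $\Gamma_1$ is relatively open in $\Gamma$. 4. $\Gamma_1$ is locally Reifenberg flat with vanishing constant. 5. $\Gamma_1$ has Hausdorff dimension $n-1$. -/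

import Mathlib

open Set Filter Topology
open scoped ENNReal

noncomputable section

/-- Euclidean `n`-space. -/
abbrev Euc (n : ℕ) : Type := EuclideanSpace ℝ (Fin n)

/-- The zero set in `ℝⁿ` of a real polynomial in `n` variables. -/
def polyZeroSet {n : ℕ} (h : MvPolynomial (Fin n) ℝ) : Set (Euc n) :=
  {x | MvPolynomial.eval (fun i => x i) h = 0}

/-- A polynomial is harmonic if its Laplacian (the sum of its pure second partial derivatives)
vanishes. -/
def IsHarmonicPoly {n : ℕ} (h : MvPolynomial (Fin n) ℝ) : Prop :=
  ∑ i, MvPolynomial.pderiv i (MvPolynomial.pderiv i h) = 0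

/-- `B` is the zero set of a (nonzero) homogeneous harmonic polynomial of degree `k`. -/
def IsHomogeneousHarmonicZeroSet {n : ℕ} (k : ℕ) (B : Set (Euc n)) : Prop :=
  ∃ h : MvPolynomial (Fin n) ℝ,
    h ≠ 0 ∧ h.IsHomogeneous k ∧ IsHarmonicPoly h ∧ B = polyZeroSet h

/-- The class `H_d` of zero sets of nonconstant harmonic polynomials `h` of degree at most `d`
with `h 0 = 0`. -/
def harmonicZeroSets (n d : ℕ) : Set (Set (Euc n)) :=
  {V | ∃ h : MvPolynomial (Fin n) ℝ,
    IsHarmonicPoly h ∧ 1 ≤ h.totalDegree ∧ h.totalDegree ≤ d ∧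
      (0 : Euc n) ∈ polyZeroSet h ∧ V = polyZeroSet h}

/-- The class `G(n, n-1)` of hyperplanes through the origin, as subsets of `ℝⁿ`. -/
def hyperplanes (n : ℕ) : Set (Set (Euc n)) :=
  {V | ∃ L : Submodule ℝ (Euc n), Module.finrank ℝ L + 1 = n ∧ V = (L : Set (Euc n))}

/-- Local closeness of `A` to the class `S` near `x` at scale `r > 0`:
`(1 / r) * inf_{V ∈ S} HD[A ∩ B(x, r), (x + V) ∩ B(x, r)]`, with closed balls. It is valued in
`[0, ∞]`, so that no junk values occur. -/
def localCloseness {n : ℕ} (S : Set (Set (Euc n))) (A : Set (Euc n)) (x : Euc n) (r : ℝ) :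
    ℝ≥0∞ :=
  (⨅ V ∈ S, Metric.hausdorffEDist (A ∩ Metric.closedBall x r)
    (((fun y => x + y) '' V) ∩ Metric.closedBall x r)) / ENNReal.ofReal r

/-- `A` is locally `δ`-close to `S`: on each compact subset `K` of `A` there is a uniform scale
below which the local closeness of `A` to `S` is at most `δ`. For closed `A` this is the same as
quantifying over compact sets `K` of the ambient space and points of `A ∩ K`
(see `locallyClose_iff_of_isClosed`); the present form is also the right one for sets that are
only relatively open in a closed set. -/
def LocallyClose {n : ℕ} (S : Set (Set (Euc n))) (δ : ℝ) (A : Set (Euc n)) : Prop :=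
  ∀ K : Set (Euc n), IsCompact K → K ⊆ A →
    ∃ r₀ : ℝ, 0 < r₀ ∧ ∀ x ∈ K, ∀ r : ℝ, 0 < r → r ≤ r₀ →
      localCloseness S A x r ≤ ENNReal.ofReal δ

theorem locallyClose_iff_of_isClosed {n : ℕ} (S : Set (Set (Euc n))) (δ : ℝ) {A : Set (Euc n)}
    (hA : IsClosed A) :
    LocallyClose S δ A ↔
      ∀ K : Set (Euc n), IsCompact K →
        ∃ r₀ : ℝ, 0 < r₀ ∧ ∀ x ∈ A ∩ K, ∀ r : ℝ, 0 < r → r ≤ r₀ →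
          localCloseness S A x r ≤ ENNReal.ofReal δ := by
  constructor
  · intro h K hK
    exact h (A ∩ K) (hK.inter_left hA) inter_subset_left
  · intro h K hK hKA
    obtain ⟨r₀, h0, h1⟩ := h K hK
    exact ⟨r₀, h0, fun x hx => h1 x ⟨hKA hx, hx⟩⟩

/-- `A` is locally well-approximated by `S`. -/
def LocallyWellApproximated {n : ℕ} (S : Set (Set (Euc n))) (A : Set (Euc n)) : Prop :=
  ∀ δ : ℝ, 0 < δ → LocallyClose S δ A

/-- `A` is locally Reifenberg flat with vanishing constant. -/
def LocallyReifenbergFlatVanishing {n : ℕ} (A : Set (Euc n)) : Prop :=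
  LocallyWellApproximated (hyperplanes n) A

/-- The local flatness `θ_A(x, r)`. -/
def localFlatness {n : ℕ} (A : Set (Euc n)) (x : Euc n) (r : ℝ) : ℝ≥0∞ :=
  localCloseness (hyperplanes n) A x r

/-- The set of flat points of `A`: the `x ∈ A` with `θ_A(x, r) → 0` as `r → 0+`. -/
def flatPoints {n : ℕ} (A : Set (Euc n)) : Set (Euc n) :=
  {x | x ∈ A ∧ Tendsto (fun r : ℝ => localFlatness A x r) (𝓝[>] 0) (𝓝 0)}

/-- `B` is a (geometric) blow-up of `A` centered at `x ∈ A`: a closed set such that, for some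
positive sequence `r i → 0`, the sets `(A - x) / r i` converge to `B` in Hausdorff distance inside
every closed ball `B(0, s)`. (The extended Hausdorff distance between an empty and a nonempty set
is `∞`.) -/
def IsBlowup {n : ℕ} (A : Set (Euc n)) (x : Euc n) (B : Set (Euc n)) : Prop :=
  x ∈ A ∧ IsClosed B ∧
    ∃ r : ℕ → ℝ, (∀ i, 0 < r i) ∧ Tendsto r atTop (𝓝 0) ∧
      ∀ s : ℝ, 0 < s →
        Tendsto (fun i => Metric.hausdorffEDist
          (((fun y => (r i)⁻¹ • (y - x)) '' A) ∩ Metric.closedBall 0 s)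
          (B ∩ Metric.closedBall 0 s)) atTop (𝓝 0)

end

noncomputable section
open MeasureTheory ProbabilityTheory MvPolynomial

/-! ### Gaussian expectations of polynomials -/

/-! The engine is a self-improvement of flatness. Harmonic polynomials of degree at most `d`, taken
up to positive scaling, form a compact family. Along coefficientwise limits with nonzero limit their
zero sets converge locally in Hausdorff distance, because a nonzero harmonic polynomial takes both
signs near each of its zeros (`PolyTendsto.eventually_near`).

Suppose such zero sets through the origin become flat in the unit ball while the linear parts become
negligible. The limit then has no linear part, but keeps one sign on a half ball. Its lowest
homogeneous component is harmonic, of degree at least 2 and one-signed on a half-space, hence zero: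
a contradiction. So a fixed flatness `δ` forces the linear part to dominate
(`exists_linear_dominates`), and then zooming by a fixed factor makes the zero set as flat as
desired (`exists_scale_flatSet_of_linear_dominates`).

Since `Γ` is close to such zero sets at small scales, `δ`-flatness of `Γ` at one small scale
propagates to all smaller scales, uniformly over nearby centres, with flatness tending to zero
(`exists_flat_propagation`, `UniformlyFlatNear`). This gives openness and vanishing Reifenberg
constant, and shows that one hyperplane blow-up makes a point flat. Conversely, a homogeneous
blow-up at a flat point is flat, so it has a dominating linear part and its degree is 1.

For the dimension, uniform flatness yields self-similar coverings by about `m ^ (n - 1)` balls of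
ratio about `1 / m`, and equally rich Cantor subsets. Flat points exist because the approximating
polynomials at any point of `Γ` have a limit, whose zero set has regular points arbitrarily near the
origin.

The vanishing theorems rest on Gaussian integration by parts: a homogeneous harmonic polynomial of
positive degree has Gaussian mean zero, so it cannot be one-signed unless it vanishes. -/

theorem integrable_pow_gaussianReal (k : ℕ) :
    Integrable (fun x : ℝ => x ^ k) (gaussianReal 0 1) := by
  have := (memLp_id_gaussianReal (μ := 0) (v := 1) k).integrable_norm_pow'
  refine (integrable_norm_iff (by fun_prop)).1 ?_
  simpa using this

/-- The derivative of the density times `x ^ k` integrates to zero. The truncated exponent `k - 1`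
is harmless at `k = 0`, where the factor `k` vanishes. -/
theorem integral_pow_succ_gaussianReal (k : ℕ) :
    ∫ x, x ^ (k + 1) ∂(gaussianReal 0 1) = k * ∫ x, x ^ (k - 1) ∂(gaussianReal 0 1) := by
  have hI : ∀ j : ℕ, Integrable (fun x : ℝ => gaussianPDFReal 0 1 x * x ^ j) := by
    intro j
    have h := integrable_pow_gaussianReal j
    rw [gaussianReal_of_var_ne_zero 0 one_ne_zero,
      integrable_withDensity_iff_integrable_smul' (by fun_prop)
        (ae_of_all _ fun x => gaussianPDF_lt_top)] at h
    simpa [toReal_gaussianPDF] using h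
  have hd : ∀ x : ℝ, HasDerivAt (fun y => gaussianPDFReal 0 1 y * y ^ k)
      (k * (gaussianPDFReal 0 1 x * x ^ (k - 1)) - gaussianPDFReal 0 1 x * x ^ (k + 1)) x := by
    intro x
    have h1 : HasDerivAt (fun y => gaussianPDFReal 0 1 y) (gaussianPDFReal 0 1 x * (-x)) x := by
      unfold gaussianPDFReal
      have h2 : HasDerivAt (fun y : ℝ => -(y - 0) ^ 2 / (2 * ((1 : NNReal) : ℝ))) (-x) x := by
        have := (((hasDerivAt_id x).sub_const 0).pow 2).neg.div_const (2 * ((1 : NNReal) : ℝ))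
        refine this.congr_deriv ?_
        simp
        ring
      refine (h2.exp.const_mul _).congr_deriv (by ring)
    refine (h1.mul (hasDerivAt_pow k x)).congr_deriv (by ring)
  have h0 := integral_eq_zero_of_hasDerivAt_of_integrable hd
    (((hI (k - 1)).const_mul _).sub (hI (k + 1))) (hI k)
  rw [integral_sub ((hI (k - 1)).const_mul _) (hI (k + 1)), integral_const_mul, sub_eq_zero] at h0
  rw [integral_gaussianReal_eq_integral_smul one_ne_zero,
    integral_gaussianReal_eq_integral_smul one_ne_zero]
  simpa using h0.symm

/-- The standard Gaussian measure on `ℝⁿ`, as a product measure. -/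
def gaussPi (n : ℕ) : Measure (Fin n → ℝ) := Measure.pi fun _ => gaussianReal 0 1

instance gaussPi_isProbabilityMeasure (n : ℕ) : IsProbabilityMeasure (gaussPi n) := by
  unfold gaussPi; infer_instance

instance gaussPi_isOpenPosMeasure (n : ℕ) : (gaussPi n).IsOpenPosMeasure := by
  have : (gaussianReal 0 1).IsOpenPosMeasure :=
    (gaussianReal_absolutelyContinuous' 0 one_ne_zero).isOpenPosMeasure
  unfold gaussPi; infer_instance

theorem integrable_eval_gaussPi {n : ℕ} (p : MvPolynomial (Fin n) ℝ) :
    Integrable (fun x => eval x p) (gaussPi n) := by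
  induction p using MvPolynomial.induction_on' with
  | monomial a r =>
    simp only [eval_monomial, Finsupp.prod_fintype, pow_zero, implies_true]
    exact (Integrable.fintype_prod (f := fun i x => x ^ a i)
      fun i => integrable_pow_gaussianReal (a i)).const_mul r
  | add p q hp hq =>
    simp only [map_add]
    exact hp.add hq

/-- The expectation of a polynomial in independent standard Gaussian variables. -/
def gaussExp {n : ℕ} : MvPolynomial (Fin n) ℝ →ₗ[ℝ] ℝ where
  toFun p := ∫ x, eval x p ∂(gaussPi n)
  map_add' p q := by
    simp only [map_add]
    exact integral_add (integrable_eval_gaussPi p) (integrable_eval_gaussPi q)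
  map_smul' r p := by
    simp only [smul_eval, RingHom.id_apply, smul_eq_mul]
    exact integral_const_mul _ _

theorem gaussExp_apply {n : ℕ} (p : MvPolynomial (Fin n) ℝ) :
    gaussExp p = ∫ x, eval x p ∂(gaussPi n) := rfl

theorem gaussExp_monomial {n : ℕ} (a : Fin n →₀ ℕ) (r : ℝ) :
    gaussExp (monomial a r) = r * ∏ i, ∫ x, x ^ a i ∂(gaussianReal 0 1) := by
  rw [gaussExp_apply]
  simp only [eval_monomial, Finsupp.prod_fintype, pow_zero, implies_true]
  rw [integral_const_mul]
  congr 1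
  exact integral_fintype_prod_eq_prod (fun i x => x ^ a i)

/-- Gaussian integration by parts. -/
theorem gaussExp_X_mul {n : ℕ} (i : Fin n) (p : MvPolynomial (Fin n) ℝ) :
    gaussExp (X i * p) = gaussExp (pderiv i p) := by
  induction p using MvPolynomial.induction_on' with
  | monomial a r =>
    rw [show X i * monomial a r = monomial (Finsupp.single i 1 + a : Fin n →₀ ℕ) r by
        simp [X, monomial_mul],
      pderiv_monomial, gaussExp_monomial, gaussExp_monomial,
      ← Finset.mul_prod_erase _ _ (Finset.mem_univ i),
      ← Finset.mul_prod_erase _ (fun j => ∫ x, x ^ _ ∂_) (Finset.mem_univ i)]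
    have h1 : ∀ j ∈ Finset.univ.erase i, (Finsupp.single i 1 + a : Fin n →₀ ℕ) j = a j := by
      intro j hj
      simp [(Finset.ne_of_mem_erase hj).symm]
    have h2 : ∀ j ∈ Finset.univ.erase i, (a - Finsupp.single i 1 : Fin n →₀ ℕ) j = a j := by
      intro j hj
      simp [(Finset.ne_of_mem_erase hj).symm]
    rw [Finset.prod_congr rfl fun j hj => by rw [h1 j hj]]
    conv_rhs => rw [Finset.prod_congr rfl fun j hj => by rw [h2 j hj]]
    have h3 : (Finsupp.single i 1 + a : Fin n →₀ ℕ) i = a i + 1 := by simp [add_comm]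
    have h4 : (a - Finsupp.single i 1 : Fin n →₀ ℕ) i = a i - 1 := by simp
    rw [h3, h4, integral_pow_succ_gaussianReal]
    ring
  | add p q hp hq => simp only [mul_add, map_add, hp, hq]

/-- The Gaussian measure charges every nonempty open set, so a nonnegative continuous function of
zero mean vanishes identically. -/
theorem eq_zero_of_gaussExp_eq_zero {n : ℕ} {p : MvPolynomial (Fin n) ℝ}
    (hp : ∀ x, 0 ≤ eval x p) (h : gaussExp p = 0) : p = 0 := by
  have hc : Continuous fun x => eval x p := MvPolynomial.continuous_eval p
  have h0 := (integral_eq_zero_iff_of_nonneg (μ := gaussPi n) hp (integrable_eval_gaussPi p)).1 h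
  have := (hc.ae_eq_iff_eq (gaussPi n) (continuous_zero)).1 h0
  exact MvPolynomial.funext fun x => by simpa using congrFun this x

/-! ### Harmonic polynomials -/

theorem IsHarmonicPoly.neg {n : ℕ} {p : MvPolynomial (Fin n) ℝ} (h : IsHarmonicPoly p) :
    IsHarmonicPoly (-p) := by
  unfold IsHarmonicPoly at *
  simp [h]

theorem IsHarmonicPoly.smul {n : ℕ} {p : MvPolynomial (Fin n) ℝ} (h : IsHarmonicPoly p) (c : ℝ) :
    IsHarmonicPoly (c • p) := by
  unfold IsHarmonicPoly at *
  simp only [Derivation.map_smul, ← Finset.smul_sum, h, smul_zero]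

theorem pderiv_comm_apply {n : ℕ} (i j : Fin n) (p : MvPolynomial (Fin n) ℝ) :
    pderiv i (pderiv j p) = pderiv j (pderiv i p) := by
  ext m
  by_cases hij : i = j
  · rw [hij]
  · simp only [coeff_pderiv]
    rw [add_right_comm]
    simp [hij, Ne.symm hij]
    ring

theorem IsHarmonicPoly.pderiv {n : ℕ} {p : MvPolynomial (Fin n) ℝ} (h : IsHarmonicPoly p)
    (j : Fin n) : IsHarmonicPoly (pderiv j p) := by
  unfold IsHarmonicPoly at *
  have : ∀ i, MvPolynomial.pderiv i (MvPolynomial.pderiv i (MvPolynomial.pderiv j p)) =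
      MvPolynomial.pderiv j (MvPolynomial.pderiv i (MvPolynomial.pderiv i p)) := by
    intro i
    rw [pderiv_comm_apply i j, pderiv_comm_apply i j]
  simp only [this, ← map_sum, h, map_zero]

theorem IsHomogeneous.pderiv_pred {n k : ℕ} {p : MvPolynomial (Fin n) ℝ} (h : p.IsHomogeneous (k + 1))
    (j : Fin n) : (pderiv j p).IsHomogeneous k := by
  intro m hm
  rw [coeff_pderiv] at hm
  have := h (left_ne_zero_of_mul hm)
  simp [Finsupp.weight_apply, Finsupp.sum_add_index', Finsupp.sum_single_index] at this ⊢
  have h2 := Finsupp.sum_add_index' (f := m) (g := Finsupp.single j 1) (h := fun _ c => c)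
    (by simp) (by simp)
  simp at h2
  omega

/-- Euler's identity and integration by parts give `k E[p] = ∑ E[X i * ∂ᵢ p] = E[Δ p] = 0`. -/
theorem gaussExp_eq_zero {n k : ℕ} (hk : k ≠ 0) {p : MvPolynomial (Fin n) ℝ}
    (hp : p.IsHomogeneous k) (hh : IsHarmonicPoly p) : gaussExp p = 0 := by
  have h1 := congrArg gaussExp hp.sum_X_mul_pderiv
  rw [map_sum] at h1
  simp only [gaussExp_X_mul] at h1
  rw [← map_sum, hh, map_zero, map_nsmul] at h1
  simpa [hk] using h1.symm

theorem eval_smul_of_isHomogeneous {n k : ℕ} {p : MvPolynomial (Fin n) ℝ} (hp : p.IsHomogeneous k)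
    (t : ℝ) (x : Fin n → ℝ) : eval (t • x) p = t ^ k * eval x p := by
  rw [eval_eq', eval_eq', Finset.mul_sum]
  refine Finset.sum_congr rfl fun m hm => ?_
  have h := hp.degree_eq_sum_deg_support hm
  have h2 : ∑ i, m i = k := by
    rw [h]
    exact (Finset.sum_subset (Finset.subset_univ _) (by simp)).symm
  simp only [Pi.smul_apply, smul_eq_mul, mul_pow, Finset.prod_mul_distrib]
  rw [Finset.prod_pow_eq_pow_sum, h2]
  ring

/-- A homogeneous harmonic polynomial of degree at least two which is nonnegative on a half-space
vanishes. -/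
theorem eq_zero_of_nonneg_halfspace {n k : ℕ} (hk : 2 ≤ k) {p : MvPolynomial (Fin n) ℝ}
    (hp : p.IsHomogeneous k) (hh : IsHarmonicPoly p) (e : Fin n → ℝ) (he : e ≠ 0)
    (hpos : ∀ x : Fin n → ℝ, 0 < ∑ i, e i * x i → 0 ≤ eval x p) : p = 0 := by
  set ℓ : MvPolynomial (Fin n) ℝ := ∑ i, e i • X i with hℓ
  have hev : ∀ x, eval x ℓ = ∑ i, e i * x i := by intro x; simp [hℓ]
  have hneg : ∀ x : Fin n → ℝ, eval (-x) p = (-1) ^ k * eval x p := by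
    intro x
    have := eval_smul_of_isHomogeneous hp (-1) x
    simpa using this
  have hℓ0 : ℓ ≠ 0 := by
    intro h
    have h2 := hev e
    rw [h] at h2
    simp only [map_zero] at h2
    apply he
    have := (Finset.sum_eq_zero_iff_of_nonneg (fun i _ => mul_self_nonneg (e i))).1 h2.symm
    ext i
    simpa using this i (Finset.mem_univ i)
  rcases Nat.even_or_odd k with hev' | hodd
  -- Even degree: `p` is symmetric, so it is nonnegative off the hyperplane `ℓ = 0`, hence
  -- everywhere by density, and it has mean zero.
  · have key : ∀ x, 0 ≤ eval x (ℓ ^ 2 * p) := by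
      intro x
      rcases lt_trichotomy (eval x ℓ) 0 with h | h | h
      · have h1 : 0 ≤ eval (-x) p := by
          apply hpos
          rw [hev] at h
          simpa using h
        rw [hneg, hev'.neg_one_pow, one_mul] at h1
        simp only [map_mul, map_pow]
        positivity
      · simp [h]
      · have h1 : 0 ≤ eval x p := hpos _ (by rwa [hev] at h)
        simp only [map_mul, map_pow]
        positivity
    have key2 : ∀ x, 0 ≤ eval x p := by
      have hd : Dense {x : Fin n → ℝ | eval x ℓ ≠ 0} := by
        intro x
        rw [mem_closure_iff_nhds]
        intro t ht
        have hc : Tendsto (fun s : ℝ => x + s • e) (𝓝[≠] 0) (𝓝 x) := by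
          have : Continuous fun s : ℝ => x + s • e := by fun_prop
          simpa using (this.tendsto 0).mono_left nhdsWithin_le_nhds
        have hee : 0 < ∑ i, e i * e i := by
          refine lt_of_le_of_ne (Finset.sum_nonneg fun i _ => mul_self_nonneg (e i)) ?_
          intro h
          apply he
          have := (Finset.sum_eq_zero_iff_of_nonneg (fun i _ => mul_self_nonneg (e i))).1 h.symm
          ext i
          simpa using this i (Finset.mem_univ i)
        have hne : ∀ᶠ s : ℝ in 𝓝[≠] 0, s ≠ -(eval x ℓ) / ∑ i, e i * e i := by
          by_cases h0 : -(eval x ℓ) / ∑ i, e i * e i = 0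
          · rw [h0]; exact self_mem_nhdsWithin
          · exact (isOpen_ne.mem_nhds (Ne.symm h0)) |> mem_nhdsWithin_of_mem_nhds
        obtain ⟨s, hs1, hs2⟩ := ((hc.eventually ht).and hne).exists
        refine ⟨x + s • e, hs1, ?_⟩
        simp only [mem_ofPred_eq]
        intro h
        apply hs2
        rw [hev] at h
        rw [hev, eq_div_iff hee.ne', eq_neg_iff_add_eq_zero, ← h, Finset.mul_sum, ← Finset.sum_add_distrib]
        refine Finset.sum_congr rfl fun i _ => ?_
        simp; ring
      intro x
      have hcl : IsClosed {x : Fin n → ℝ | 0 ≤ eval x p} :=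
        isClosed_le continuous_const (MvPolynomial.continuous_eval p)
      refine (hd.mono ?_).closure_eq.symm.subset.trans hcl.closure_subset (mem_univ x)
      intro y hy
      have := key y
      simp only [map_mul, map_pow] at this
      exact nonneg_of_mul_nonneg_right this (by have : eval y ℓ ≠ 0 := hy; positivity)
    exact eq_zero_of_gaussExp_eq_zero key2 (gaussExp_eq_zero (by omega) hp hh)
  -- Odd degree: `p` and `ℓ` both change sign under `x ↦ -x`, so `ℓ * p` is nonnegative everywhere.
  · have key : ∀ x, 0 ≤ eval x (ℓ * p) := by
      intro x
      rcases lt_trichotomy (eval x ℓ) 0 with h | h | h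
      · have h1 : 0 ≤ eval (-x) p := by
          apply hpos
          rw [hev] at h
          simpa using h
        rw [hneg, hodd.neg_one_pow] at h1
        simp only [map_mul]
        nlinarith
      · simp [h]
      · have h1 : 0 ≤ eval x p := hpos _ (by rwa [hev] at h)
        simp only [map_mul]
        positivity
    -- The mean of `ℓ * p` is a combination of means of the `∂ᵢ p`, which are homogeneous harmonic
    -- of degree `k - 1 ≥ 1`.
    have h0 : gaussExp (ℓ * p) = 0 := by
      rw [hℓ, Finset.sum_mul, map_sum]
      refine Finset.sum_eq_zero fun i _ => ?_
      rw [smul_mul_assoc, map_smul, gaussExp_X_mul]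
      obtain ⟨k', rfl⟩ : ∃ k', k = k' + 1 := ⟨k - 1, by omega⟩
      rw [gaussExp_eq_zero (by omega) (IsHomogeneous.pderiv_pred hp i) (hh.pderiv i), smul_zero]
    exact (mul_eq_zero.1 (eq_zero_of_gaussExp_eq_zero key h0)).resolve_left hℓ0

end

noncomputable section
open MvPolynomial

/-! ### Evaluation, affine substitution and lowest order terms -/

/-- Evaluation of a polynomial at a point of Euclidean space. -/
def ev {n : ℕ} (h : MvPolynomial (Fin n) ℝ) (x : Euc n) : ℝ := eval (fun i => x i) h

theorem mem_polyZeroSet {n : ℕ} {h : MvPolynomial (Fin n) ℝ} {x : Euc n} :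
    x ∈ polyZeroSet h ↔ ev h x = 0 := Iff.rfl

theorem continuous_ev {n : ℕ} (h : MvPolynomial (Fin n) ℝ) : Continuous (ev h) := by
  unfold ev
  exact (MvPolynomial.continuous_eval h).comp (by fun_prop)

theorem isClosed_polyZeroSet {n : ℕ} (h : MvPolynomial (Fin n) ℝ) : IsClosed (polyZeroSet h) :=
  isClosed_eq (continuous_ev h) continuous_const

theorem ev_zero_eq {n : ℕ} (h : MvPolynomial (Fin n) ℝ) : ev h 0 = coeff 0 h := by
  unfold ev
  rw [← constantCoeff_eq, ← eval_zero]
  rfl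

theorem ev_neg {n : ℕ} (h : MvPolynomial (Fin n) ℝ) (x : Euc n) : ev (-h) x = -ev h x := by
  simp [ev]

theorem ev_smul {n : ℕ} (c : ℝ) (h : MvPolynomial (Fin n) ℝ) (x : Euc n) :
    ev (c • h) x = c * ev h x := by
  simp [ev, smul_eval]

theorem polyZeroSet_smul {n : ℕ} {c : ℝ} (hc : c ≠ 0) (h : MvPolynomial (Fin n) ℝ) :
    polyZeroSet (c • h) = polyZeroSet h := by
  ext x
  simp [mem_polyZeroSet, ev_smul, hc]

theorem eq_zero_of_ev_eq_zero {n : ℕ} {h : MvPolynomial (Fin n) ℝ} (H : ∀ x, ev h x = 0) :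
    h = 0 :=
  MvPolynomial.funext fun x => by simpa [ev] using H (WithLp.toLp 2 x)

theorem totalDegree_le_of_degree_le {n d : ℕ} {p : MvPolynomial (Fin n) ℝ}
    (h : ∀ m ∈ p.support, m.degree ≤ d) : p.totalDegree ≤ d :=
  Finset.sup_le h

theorem degree_le_of_coeff_ne_zero {n d : ℕ} {p : MvPolynomial (Fin n) ℝ}
    (hp : p.totalDegree ≤ d) {m : Fin n →₀ ℕ} (h : coeff m p ≠ 0) : m.degree ≤ d :=
  (le_totalDegree (mem_support_iff.2 h)).trans hp

theorem exists_single_of_degree_eq_one {n : ℕ} {m : Fin n →₀ ℕ} (h : m.degree = 1) :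
    ∃ i, m = Finsupp.single i 1 := by
  have h0 : m ≠ 0 := by rintro rfl; simp at h
  obtain ⟨i, hi⟩ := DFunLike.ne_iff.1 h0
  have hle : Finsupp.single i 1 ≤ m := by
    rw [Finsupp.single_le_iff]
    exact Nat.one_le_iff_ne_zero.2 hi
  have h1 := add_tsub_cancel_of_le hle
  have h2 := congrArg Finsupp.degree h1
  rw [map_add, Finsupp.degree_single, h] at h2
  have h3 : m - Finsupp.single i 1 = 0 := by
    rw [← Finsupp.degree_eq_zero_iff]
    omega
  exact ⟨i, by rw [← h1, h3, add_zero]⟩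

/-- The polynomial `x ↦ h (y + r x)`. -/
def aff {n : ℕ} (h : MvPolynomial (Fin n) ℝ) (y : Euc n) (r : ℝ) : MvPolynomial (Fin n) ℝ :=
  bind₁ (fun i => C (y i) + C r * X i) h

theorem ev_aff {n : ℕ} (h : MvPolynomial (Fin n) ℝ) (y : Euc n) (r : ℝ) (x : Euc n) :
    ev (aff h y r) x = ev h (y + r • x) := by
  unfold ev aff
  rw [eval, eval₂Hom_bind₁]
  simp

theorem aff_ne_zero {n : ℕ} {h : MvPolynomial (Fin n) ℝ} (h0 : h ≠ 0) (y : Euc n) {r : ℝ}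
    (hr : r ≠ 0) : aff h y r ≠ 0 := by
  intro H
  apply h0
  refine eq_zero_of_ev_eq_zero fun x => ?_
  have := ev_aff h y r (r⁻¹ • (x - y))
  rw [H, smul_smul, mul_inv_cancel₀ hr, one_smul, add_sub_cancel] at this
  rw [← this]
  simp [ev]

theorem pderiv_aff {n : ℕ} (h : MvPolynomial (Fin n) ℝ) (y : Euc n) (r : ℝ) (i : Fin n) :
    pderiv i (aff h y r) = C r * aff (pderiv i h) y r := by
  unfold aff
  induction h using MvPolynomial.induction_on with
  | C a => simp
  | add p q hp hq => simp only [map_add, hp, hq, mul_add]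
  | mul_X p j hp =>
    simp only [map_mul, bind₁_X_right, pderiv_mul, hp, map_add, pderiv_C, pderiv_X]
    by_cases hij : i = j
    · subst hij; simp; ring
    · simp [hij]; ring

theorem IsHarmonicPoly.aff {n : ℕ} {h : MvPolynomial (Fin n) ℝ} (hh : IsHarmonicPoly h)
    (y : Euc n) (r : ℝ) : IsHarmonicPoly (aff h y r) := by
  unfold IsHarmonicPoly at *
  have : ∀ i, MvPolynomial.pderiv i (MvPolynomial.pderiv i (_root_.aff h y r)) =
      C r * (C r * _root_.aff (MvPolynomial.pderiv i (MvPolynomial.pderiv i h)) y r) := by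
    intro i
    rw [pderiv_aff, pderiv_C_mul, pderiv_aff]
  simp only [this, ← Finset.mul_sum]
  have h2 : ∑ i, _root_.aff (MvPolynomial.pderiv i (MvPolynomial.pderiv i h)) y r = 0 := by
    simp only [_root_.aff]
    rw [← map_sum, hh, map_zero]
  simp [h2]

theorem coeff_aff_zero {n : ℕ} (h : MvPolynomial (Fin n) ℝ) (s : ℝ) (α : Fin n →₀ ℕ) :
    coeff α (aff h 0 s) = s ^ α.degree * coeff α h := by
  unfold aff
  induction h using MvPolynomial.induction_on' with
  | monomial a r =>
    have : bind₁ (fun i => C ((0 : Euc n) i) + C s * X i) (monomial a r) =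
        monomial a (r * s ^ a.degree) := by
      rw [bind₁_monomial, Finset.prod_congr rfl fun i _ => by
        rw [PiLp.zero_apply, C_0, zero_add, mul_pow, ← C_pow], Finset.prod_mul_distrib,
        ← map_prod, Finset.prod_pow_eq_pow_sum, monomial_eq, C_mul, mul_assoc]
      rfl
    rw [this, coeff_monomial, coeff_monomial]
    split_ifs with h1
    · rw [h1, mul_comm]
    · simp
  | add p q hp hq => simp only [map_add, coeff_add, hp, hq, mul_add]

theorem totalDegree_aff_zero_le {n : ℕ} (h : MvPolynomial (Fin n) ℝ) (s : ℝ) :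
    (aff h 0 s).totalDegree ≤ h.totalDegree := by
  refine totalDegree_le_of_degree_le fun m hm => ?_
  rw [mem_support_iff, coeff_aff_zero] at hm
  exact degree_le_of_coeff_ne_zero le_rfl (right_ne_zero_of_mul hm)

theorem IsHarmonicPoly.homogeneousComponent {n : ℕ} {h : MvPolynomial (Fin n) ℝ}
    (hh : IsHarmonicPoly h) (k : ℕ) : IsHarmonicPoly (homogeneousComponent k h) := by
  unfold IsHarmonicPoly at *
  ext m
  have h1 := congrArg (coeff m) hh
  simp only [coeff_sum, coeff_pderiv, coeff_homogeneousComponent, coeff_zero] at h1 ⊢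
  have hdeg : ∀ i : Fin n, (m + Finsupp.single i 1 + Finsupp.single i 1).degree = m.degree + 2 := by
    intro i; simp [map_add]
  simp only [hdeg]
  split_ifs with hk
  · exact h1
  · simp

/-- The lowest nonzero component governs `h (t x)` as `t ↓ 0`, so it inherits the sign of `h` along
each ray; `h 0 = 0` excludes degree zero. -/
theorem exists_lowest_component {n : ℕ} {h : MvPolynomial (Fin n) ℝ} (h0 : h ≠ 0)
    (hz : ev h 0 = 0) :
    ∃ k, k ≠ 0 ∧ homogeneousComponent k h ≠ 0 ∧
      ∀ x : Euc n, (∀ᶠ t in 𝓝[>] (0 : ℝ), 0 ≤ ev h (t • x)) →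
        0 ≤ ev (homogeneousComponent k h) x := by
  classical
  have hex : ∃ k, homogeneousComponent k h ≠ 0 := by
    by_contra! H
    apply h0
    rw [← sum_homogeneousComponent h]
    exact Finset.sum_eq_zero fun i _ => H i
  refine ⟨Nat.find hex, ?_, Nat.find_spec hex, ?_⟩
  · intro hk
    have := Nat.find_spec hex
    rw [hk, homogeneousComponent_zero, ← ev_zero_eq, hz] at this
    simp at this
  · intro x hx
    set k := Nat.find hex with hk
    -- `f t` is `h (t x) / t ^ k` written as a polynomial in `t`; the `if` discards the indices for
    -- which `j - k` truncates.
    set f : ℝ → ℝ := fun t => ∑ j ∈ Finset.range (h.totalDegree + 1),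
      t ^ (j - k) * (if j < k then 0 else ev (homogeneousComponent j h) x) with hf
    have hcont : Continuous f := by
      rw [hf]; fun_prop
    have hf0 : f 0 = ev (homogeneousComponent k h) x := by
      rw [hf]
      simp only
      rw [Finset.sum_eq_single k]
      · simp
      · intro j _ hj
        by_cases hjk : j < k
        · simp [hjk]
        · have : j - k ≠ 0 := by omega
          simp [this]
      · intro hk'
        have : h.totalDegree < k := by simpa using hk'
        simp [homogeneousComponent_eq_zero _ _ this, ev]
    have hft : ∀ t : ℝ, ev h (t • x) = t ^ k * f t := by
      intro t
      conv_lhs => rw [← sum_homogeneousComponent h]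
      unfold ev
      rw [map_sum, hf, Finset.mul_sum]
      refine Finset.sum_congr rfl fun j _ => ?_
      have h1 := eval_smul_of_isHomogeneous (homogeneousComponent_isHomogeneous j h) t
        (fun i => x i)
      have h2 : (fun i => (t • x) i) = t • (fun i => x i) := by ext i; simp
      rw [h2, h1]
      by_cases hjk : j < k
      · have : homogeneousComponent j h = 0 := by
          by_contra hne
          exact Nat.find_min hex hjk hne
        rw [if_pos hjk]
        simp [this]
      · simp only [hjk, if_false, ev]
        rw [← mul_assoc, ← pow_add]
        congr 2
        omega
    have hlim : Tendsto f (𝓝[>] 0) (𝓝 (f 0)) := (hcont.tendsto 0).mono_left nhdsWithin_le_nhds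
    rw [← hf0]
    refine ge_of_tendsto hlim ?_
    filter_upwards [hx, self_mem_nhdsWithin] with t ht ht0
    rw [hft] at ht
    exact nonneg_of_mul_nonneg_right ht (pow_pos ht0 k)

theorem inner_eq_sum {n : ℕ} (x y : Euc n) : inner ℝ x y = ∑ i, x i * y i := by
  simp [PiLp.inner_apply, mul_comm]

/-- A Hopf type lemma: a harmonic polynomial vanishing at the origin and nonnegative on one side
of it has a nonzero differential there. -/
theorem exists_linear_coeff_ne_zero {n : ℕ} {h : MvPolynomial (Fin n) ℝ} (h0 : h ≠ 0)
    (hh : IsHarmonicPoly h) (hz : ev h 0 = 0) {e : Euc n} (he : e ≠ 0)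
    (hpos : ∀ x : Euc n, 0 < inner ℝ e x → ∀ᶠ t in 𝓝[>] (0 : ℝ), 0 ≤ ev h (t • x)) :
    ∃ i, coeff (Finsupp.single i 1) h ≠ 0 := by
  obtain ⟨k, hk0, hk, hk2⟩ := exists_lowest_component h0 hz
  have hk1 : k ≤ 1 := by
    by_contra hlt
    apply hk
    refine eq_zero_of_nonneg_halfspace (by omega) (homogeneousComponent_isHomogeneous k h)
      (hh.homogeneousComponent k) (fun i => e i) ?_ ?_
    · intro H
      apply he
      ext i
      exact congrFun H i
    · intro x hx
      refine hk2 (WithLp.toLp 2 x) (hpos _ ?_)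
      rw [inner_eq_sum]
      exact hx
  have hk1' : k = 1 := by omega
  subst hk1'
  by_contra! H
  apply hk
  ext m
  rw [coeff_homogeneousComponent]
  split_ifs with hm
  · obtain ⟨i, rfl⟩ := exists_single_of_degree_eq_one hm
    simpa using H i
  · simp

/-- A weak maximum principle: if `h ≤ 0` near `y`, the lowest component of `-h` at `y` is
nonnegative everywhere and has Gaussian mean zero. -/
theorem exists_pos_near {n : ℕ} {h : MvPolynomial (Fin n) ℝ} (h0 : h ≠ 0)
    (hh : IsHarmonicPoly h) {y : Euc n} (hz : ev h y = 0) {ε : ℝ} (hε : 0 < ε) :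
    ∃ p, dist p y < ε ∧ 0 < ev h p := by
  by_contra! H
  have g0 : -aff h y 1 ≠ 0 := neg_ne_zero.2 (aff_ne_zero h0 y one_ne_zero)
  obtain ⟨k, hk0, hk, hk2⟩ := exists_lowest_component g0
    (by rw [ev_neg, ev_aff]; simp [hz])
  apply hk
  refine eq_zero_of_gaussExp_eq_zero (fun x => hk2 (WithLp.toLp 2 x) ?_)
    (gaussExp_eq_zero hk0 (homogeneousComponent_isHomogeneous k _)
      ((hh.aff y 1).neg.homogeneousComponent k))
  have hc : Tendsto (fun t : ℝ => y + (1 : ℝ) • t • WithLp.toLp 2 x) (𝓝[>] 0) (𝓝 y) := by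
    have : Continuous fun t : ℝ => y + (1 : ℝ) • t • WithLp.toLp 2 x := by fun_prop
    simpa using (this.tendsto 0).mono_left nhdsWithin_le_nhds
  filter_upwards [hc.eventually (Metric.ball_mem_nhds y hε)] with t ht
  rw [ev_neg, ev_aff]
  have := H _ ht
  linarith

/-! ### Coefficientwise convergence of polynomials of bounded degree -/

/-- Coefficientwise convergence of polynomials of degree at most `d`. -/
structure PolyTendsto {n : ℕ} (d : ℕ) (g : ℕ → MvPolynomial (Fin n) ℝ)
    (h : MvPolynomial (Fin n) ℝ) : Prop where
  deg : ∀ i, (g i).totalDegree ≤ d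
  lim : ∀ α, Tendsto (fun i => coeff α (g i)) atTop (𝓝 (coeff α h))

/-- A finite set of exponents containing all those of degree at most `d`. -/
def expBox (n d : ℕ) : Finset (Fin n →₀ ℕ) :=
  Finset.Icc 0 (Finsupp.equivFunOnFinite.symm fun _ => d)

theorem coeff_eq_zero_of_notMem_expBox {n d : ℕ} {p : MvPolynomial (Fin n) ℝ}
    (hp : p.totalDegree ≤ d) {α : Fin n →₀ ℕ} (hα : α ∉ expBox n d) : coeff α p = 0 := by
  by_contra h
  apply hα
  rw [expBox, Finset.mem_Icc]
  refine ⟨zero_le, fun i => ?_⟩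
  have h1 := le_totalDegree (mem_support_iff.2 h)
  exact (Finsupp.le_degree i α).trans (h1.trans hp)

theorem ev_eq_sum {n d : ℕ} {p : MvPolynomial (Fin n) ℝ} (hp : p.totalDegree ≤ d) (x : Euc n) :
    ev p x = ∑ α ∈ expBox n d, coeff α p * ∏ i, x i ^ α i := by
  unfold ev
  rw [eval_eq']
  refine Finset.sum_subset ?_ ?_
  · intro α hα
    by_contra h
    exact (mem_support_iff.1 hα) (coeff_eq_zero_of_notMem_expBox hp h)
  · intro α _ hα
    simp [notMem_support_iff.1 hα]

theorem PolyTendsto.deg_limit {n d : ℕ} {g : ℕ → MvPolynomial (Fin n) ℝ}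
    {h : MvPolynomial (Fin n) ℝ} (H : PolyTendsto d g h) : h.totalDegree ≤ d := by
  refine totalDegree_le_of_degree_le fun m hm => ?_
  by_contra hlt
  apply mem_support_iff.1 hm
  have : ∀ i, coeff m (g i) = 0 := by
    intro i
    by_contra h
    exact hlt (degree_le_of_coeff_ne_zero (H.deg i) h)
  have h2 := H.lim m
  simp only [this] at h2
  exact tendsto_nhds_unique h2 tendsto_const_nhds

theorem PolyTendsto.tendsto_ev {n d : ℕ} {g : ℕ → MvPolynomial (Fin n) ℝ}
    {h : MvPolynomial (Fin n) ℝ} (H : PolyTendsto d g h) (x : Euc n) :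
    Tendsto (fun q : ℕ × Euc n => ev (g q.1) q.2) (atTop ×ˢ 𝓝 x) (𝓝 (ev h x)) := by
  simp only [ev_eq_sum H.deg_limit, ev_eq_sum (H.deg _)]
  refine tendsto_finsetSum _ fun α _ => Tendsto.mul ((H.lim α).comp tendsto_fst) ?_
  have : Continuous fun y : Euc n => ∏ i, y i ^ α i := by fun_prop
  exact (this.tendsto x).comp tendsto_snd

theorem PolyTendsto.isHarmonicPoly {n d : ℕ} {g : ℕ → MvPolynomial (Fin n) ℝ}
    {h : MvPolynomial (Fin n) ℝ} (H : PolyTendsto d g h) (hg : ∀ i, IsHarmonicPoly (g i)) :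
    IsHarmonicPoly h := by
  unfold IsHarmonicPoly at *
  ext m
  have h1 : ∀ i, coeff m (∑ j, pderiv j (pderiv j (g i))) = 0 := fun i => by rw [hg i]; rfl
  simp only [coeff_sum, coeff_pderiv, coeff_zero] at h1 ⊢
  have h2 : Tendsto (fun i => ∑ j : Fin n, coeff (m + Finsupp.single j 1 + Finsupp.single j 1) (g i) *
      (((m + Finsupp.single j 1 : Fin n →₀ ℕ) j : ℝ) + 1) * ((m j : ℝ) + 1)) atTop
      (𝓝 (∑ j : Fin n, coeff (m + Finsupp.single j 1 + Finsupp.single j 1) h *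
      (((m + Finsupp.single j 1 : Fin n →₀ ℕ) j : ℝ) + 1) * ((m j : ℝ) + 1))) :=
    tendsto_finsetSum _ fun j _ => ((H.lim _).mul_const _).mul_const _
  simp only [h1] at h2
  exact tendsto_nhds_unique h2 tendsto_const_nhds

/-- The coefficient vectors, normalized to the unit sphere of a finite-dimensional space, have a
convergent subsequence. The limit has norm one, so it is nonzero, and positive factors do not change
zero sets. -/
theorem exists_polyTendsto {n d : ℕ} (g : ℕ → MvPolynomial (Fin n) ℝ) (hg : ∀ i, g i ≠ 0)
    (hd : ∀ i, (g i).totalDegree ≤ d) :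
    ∃ φ : ℕ → ℕ, StrictMono φ ∧ ∃ c : ℕ → ℝ, (∀ i, 0 < c i) ∧ ∃ h, h ≠ 0 ∧
      PolyTendsto d (fun i => c i • g (φ i)) h := by
  set v : ℕ → (expBox n d → ℝ) := fun i α => coeff α.1 (g i) with hv
  have hv0 : ∀ i, v i ≠ 0 := by
    intro i H
    apply hg i
    ext α
    by_cases hα : α ∈ expBox n d
    · exact congrFun H ⟨α, hα⟩
    · rw [coeff_eq_zero_of_notMem_expBox (hd i) hα, coeff_zero]
  have hmem : ∀ i, ‖v i‖⁻¹ • v i ∈ Metric.sphere (0 : expBox n d → ℝ) 1 := by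
    intro i
    simp [norm_smul, inv_mul_cancel₀ (norm_ne_zero_iff.2 (hv0 i))]
  obtain ⟨w, hw, φ, hφ, hlim⟩ := (isCompact_sphere (0 : expBox n d → ℝ) 1).tendsto_subseq hmem
  refine ⟨φ, hφ, fun i => ‖v (φ i)‖⁻¹, fun i => inv_pos.2 (norm_pos_iff.2 (hv0 _)),
    ∑ α : expBox n d, monomial α.1 (w α), ?_, ?_⟩
  · intro H
    have hw0 : w = 0 := by
      ext α
      have := congrArg (coeff α.1) H
      simpa [coeff_sum, coeff_monomial, Subtype.coe_inj, Finset.sum_ite_eq'] using this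
    simp [hw0] at hw
  · refine ⟨fun i => (totalDegree_smul_le _ _).trans (hd _), fun α => ?_⟩
    by_cases hα : α ∈ expBox n d
    · have h1 := (tendsto_pi_nhds.1 hlim) ⟨α, hα⟩
      have h2 : coeff α (∑ α : expBox n d, monomial α.1 (w α)) = w ⟨α, hα⟩ := by
        rw [coeff_sum, Finset.sum_eq_single ⟨α, hα⟩]
        · simp
        · intro b _ hb
          rw [coeff_monomial, if_neg]
          intro h
          exact hb (Subtype.ext h)
        · simp
      rw [h2]
      simpa [hv] using h1
    · have h2 : coeff α (∑ α : expBox n d, monomial α.1 (w α)) = 0 := by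
        rw [coeff_sum]
        refine Finset.sum_eq_zero fun b _ => ?_
        rw [coeff_monomial, if_neg]
        rintro rfl
        exact hα b.2
      rw [h2]
      simp only [coeff_smul, coeff_eq_zero_of_notMem_expBox (hd _) hα, smul_zero]
      exact tendsto_const_nhds

end

noncomputable section
open MvPolynomial

/-! ### Zooming in, and closeness of sets inside a ball -/

/-- The set `A` seen from `x` at scale `r`. -/
def zoom {n : ℕ} (A : Set (Euc n)) (x : Euc n) (r : ℝ) : Set (Euc n) := {z | x + r • z ∈ A}

theorem mem_zoom {n : ℕ} {A : Set (Euc n)} {x : Euc n} {r : ℝ} {z : Euc n} :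
    z ∈ zoom A x r ↔ x + r • z ∈ A := Iff.rfl

/-- Each point of one of the sets in the ball `B(0, R)` is `ε`-close to the other set. -/
def Near {n : ℕ} (A B : Set (Euc n)) (R ε : ℝ) : Prop :=
  (∀ a ∈ A, ‖a‖ ≤ R → ∃ b ∈ B, dist a b ≤ ε) ∧ (∀ b ∈ B, ‖b‖ ≤ R → ∃ a ∈ A, dist b a ≤ ε)

/-- The hyperplane orthogonal to `e`. -/
def hyp {n : ℕ} (e : Euc n) : Set (Euc n) := {z | inner ℝ e z = 0}

theorem mem_hyp {n : ℕ} {e z : Euc n} : z ∈ hyp e ↔ inner ℝ e z = 0 := Iff.rfl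

/-- In the unit ball, `A` is `ε`-close to some hyperplane through the origin. -/
def FlatSet {n : ℕ} (A : Set (Euc n)) (ε : ℝ) : Prop :=
  ∃ e : Euc n, ‖e‖ = 1 ∧ Near A (hyp e) 1 ε

variable {n : ℕ} {A B C' : Set (Euc n)}

theorem Near.symm {R ε : ℝ} (h : Near A B R ε) : Near B A R ε := ⟨h.2, h.1⟩

theorem Near.mono {R R' ε ε' : ℝ} (h : Near A B R ε) (hR : R' ≤ R) (hε : ε ≤ ε') :
    Near A B R' ε' := by
  refine ⟨fun a ha hn => ?_, fun a ha hn => ?_⟩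
  · obtain ⟨b, hb, hd⟩ := h.1 a ha (hn.trans hR)
    exact ⟨b, hb, hd.trans hε⟩
  · obtain ⟨b, hb, hd⟩ := h.2 a ha (hn.trans hR)
    exact ⟨b, hb, hd.trans hε⟩

theorem norm_le_add_of_dist_le {a b : Euc n} {R ε : ℝ} (ha : ‖a‖ ≤ R) (h : dist a b ≤ ε) :
    ‖b‖ ≤ R + ε := by
  have := norm_le_norm_add_norm_sub' b a
  rw [← dist_eq_norm, dist_comm] at this
  linarith

/-- `Near` does not ask the companion point to lie in the ball, so the intermediate point may leave
radius `t` by the error; the last two inequalities leave room for this. -/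
theorem Near.trans {R R' t ε ε' : ℝ} (h : Near A B R ε) (h' : Near B C' R' ε')
    (ht : t ≤ R) (ht' : t ≤ R') (h1 : t + ε ≤ R') (h2 : t + ε' ≤ R) :
    Near A C' t (ε + ε') := by
  refine ⟨fun a ha hn => ?_, fun c hc hn => ?_⟩
  · obtain ⟨b, hb, hd⟩ := h.1 a ha (hn.trans ht)
    obtain ⟨c, hc, hd'⟩ := h'.1 b hb ((norm_le_add_of_dist_le hn hd).trans h1)
    exact ⟨c, hc, (dist_triangle _ b _).trans (add_le_add hd hd')⟩
  · obtain ⟨b, hb, hd⟩ := h'.2 c hc (hn.trans ht')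
    obtain ⟨a, ha, hd'⟩ := h.2 b hb ((norm_le_add_of_dist_le hn hd).trans h2)
    refine ⟨a, ha, (dist_triangle _ b _).trans ?_⟩
    linarith

theorem norm_add_smul_le {y a : Euc n} {s R : ℝ} (hs : 0 < s) (ha : ‖a‖ ≤ R) :
    ‖y + s • a‖ ≤ ‖y‖ + s * R := by
  refine (norm_add_le _ _).trans ?_
  rw [norm_smul, Real.norm_of_nonneg hs.le]
  gcongr

theorem dist_inv_smul_sub {y a b : Euc n} {s : ℝ} (hs : 0 < s) :
    dist a (s⁻¹ • (b - y)) = dist (y + s • a) b / s := by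
  have : a - s⁻¹ • (b - y) = s⁻¹ • (y + s • a - b) := by
    rw [smul_sub, smul_sub, smul_add, smul_smul, inv_mul_cancel₀ hs.ne', one_smul]
    abel
  rw [dist_eq_norm, this, norm_smul, norm_inv, Real.norm_of_nonneg hs.le, ← dist_eq_norm,
    inv_mul_eq_div]

theorem add_smul_inv_smul_sub {y b : Euc n} {s : ℝ} (hs : s ≠ 0) :
    y + s • s⁻¹ • (b - y) = b := by
  rw [smul_smul, mul_inv_cancel₀ hs, one_smul, add_sub_cancel]

theorem Near.zoom {R R' s ε : ℝ} (h : Near A B R ε) (y : Euc n) (hs : 0 < s)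
    (hR : ‖y‖ + s * R' ≤ R) : Near (zoom A y s) (zoom B y s) R' (ε / s) := by
  refine ⟨fun a ha hn => ?_, fun a ha hn => ?_⟩
  · obtain ⟨b, hb, hd⟩ := h.1 _ ha ((norm_add_smul_le hs hn).trans hR)
    refine ⟨s⁻¹ • (b - y), ?_, ?_⟩
    · rwa [mem_zoom, add_smul_inv_smul_sub hs.ne']
    · rw [dist_inv_smul_sub hs]
      gcongr
  · obtain ⟨b, hb, hd⟩ := h.2 _ ha ((norm_add_smul_le hs hn).trans hR)
    refine ⟨s⁻¹ • (b - y), ?_, ?_⟩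
    · rwa [mem_zoom, add_smul_inv_smul_sub hs.ne']
    · rw [dist_inv_smul_sub hs]
      gcongr

theorem zoom_zoom (A : Set (Euc n)) (x y : Euc n) (r s : ℝ) :
    zoom (zoom A x r) y s = zoom A (x + r • y) (r * s) := by
  ext z
  simp only [mem_zoom, smul_add, smul_smul, add_assoc]

theorem zoom_polyZeroSet (h : MvPolynomial (Fin n) ℝ) (y : Euc n) (r : ℝ) :
    zoom (polyZeroSet h) y r = polyZeroSet (aff h y r) := by
  ext z
  rw [mem_zoom, mem_polyZeroSet, mem_polyZeroSet, ev_aff]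

theorem zoom_hyp {e y : Euc n} (hy : y ∈ hyp e) {s : ℝ} (hs : s ≠ 0) :
    zoom (hyp e) y s = hyp e := by
  ext z
  rw [mem_zoom, mem_hyp, mem_hyp, inner_add_right, inner_smul_right, mem_hyp.1 hy]
  simp [hs]

theorem zero_mem_hyp (e : Euc n) : (0 : Euc n) ∈ hyp e := inner_zero_right _

theorem smul_mem_hyp {e z : Euc n} (hz : z ∈ hyp e) (c : ℝ) : c • z ∈ hyp e := by
  rw [mem_hyp, inner_smul_right, mem_hyp.1 hz, mul_zero]

theorem add_mem_hyp {e z w : Euc n} (hz : z ∈ hyp e) (hw : w ∈ hyp e) : z + w ∈ hyp e := by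
  rw [mem_hyp, inner_add_right, mem_hyp.1 hz, mem_hyp.1 hw, add_zero]

theorem sub_mem_hyp {e z w : Euc n} (hz : z ∈ hyp e) (hw : w ∈ hyp e) : z - w ∈ hyp e := by
  rw [mem_hyp, inner_sub_right, mem_hyp.1 hz, mem_hyp.1 hw, sub_zero]

theorem FlatSet.mono {ε ε' : ℝ} (h : FlatSet A ε) (hε : ε ≤ ε') : FlatSet A ε' := by
  obtain ⟨e, he, hN⟩ := h
  exact ⟨e, he, hN.mono le_rfl hε⟩

/-! ### Convergence of zero sets of harmonic polynomials -/

theorem exists_ev_eq_zero_of_sign_change {h : MvPolynomial (Fin n) ℝ} {p q y : Euc n} {ε : ℝ}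
    (hp : dist p y < ε) (hq : dist q y < ε) (h1 : 0 < ev h p) (h2 : ev h q < 0) :
    ∃ z, dist z y < ε ∧ ev h z = 0 := by
  have hc : IsPreconnected (Metric.ball y ε) := (convex_ball y ε).isPreconnected
  obtain ⟨z, hz, hz0⟩ := hc.intermediate_value (Metric.mem_ball.2 hq) (Metric.mem_ball.2 hp)
    (continuous_ev h).continuousOn ⟨h2.le, h1.le⟩
  exact ⟨z, hz, hz0⟩

theorem PolyTendsto.tendsto_ev_const {d : ℕ} {g : ℕ → MvPolynomial (Fin n) ℝ}
    {h : MvPolynomial (Fin n) ℝ} (H : PolyTendsto d g h) (x : Euc n) :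
    Tendsto (fun i => ev (g i) x) atTop (𝓝 (ev h x)) := by
  simp only [ev_eq_sum H.deg_limit, ev_eq_sum (H.deg _)]
  exact tendsto_finsetSum _ fun α _ => (H.lim α).mul_const _

/-- Where `h` does not vanish, neither does `g i` nearby, by locally uniform convergence. Near a
zero of `h`, harmonicity gives points of both signs, which persist for `g i` and enclose a zero. -/
theorem PolyTendsto.eventually_near {d : ℕ} {g : ℕ → MvPolynomial (Fin n) ℝ}
    {h : MvPolynomial (Fin n) ℝ} (H : PolyTendsto d g h) (h0 : h ≠ 0) (hh : IsHarmonicPoly h)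
    (R : ℝ) {η : ℝ} (hη : 0 < η) :
    ∀ᶠ i in atTop, Near (polyZeroSet (g i)) (polyZeroSet h) R η := by
  have hK : IsCompact (Metric.closedBall (0 : Euc n) R) := isCompact_closedBall 0 R
  -- Compactness of the ball turns a statement local in `y` into one uniform in `y`.
  have key : ∀ (P : ℕ → Euc n → Prop),
      (∀ y ∈ Metric.closedBall (0 : Euc n) R, ∀ᶠ q in atTop ×ˢ 𝓝 y, P q.1 q.2) →
      ∀ᶠ i in atTop, ∀ y ∈ Metric.closedBall (0 : Euc n) R, P i y := by
    intro P hP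
    have := hK.mem_prod_nhdsSet_of_forall (l := atTop) (s := {q : ℕ × Euc n | P q.1 q.2}) hP
    exact (Filter.Eventually.curry (p := fun q : ℕ × Euc n => P q.1 q.2) this).mono
      fun i hi y hy => hi.self_of_nhdsSet y hy
  have hA := key (fun i y => ev (g i) y = 0 → ∃ b ∈ polyZeroSet h, dist y b ≤ η) (by
    intro y _
    by_cases hy : ev h y = 0
    · have : ∀ᶠ z in 𝓝 y, dist z y ≤ η := Metric.closedBall_mem_nhds y hη
      filter_upwards [(tendsto_snd (f := (atTop : Filter ℕ))).eventually this] with q hq _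
      exact ⟨y, hy, hq⟩
    · filter_upwards [(H.tendsto_ev y).eventually_ne hy] with q hq hq0
      exact absurd hq0 hq)
  have hB := key (fun i y => ev h y = 0 → ∃ a ∈ polyZeroSet (g i), dist y a ≤ η) (by
    intro y _
    by_cases hy : ev h y = 0
    · obtain ⟨p, hp, hp0⟩ := exists_pos_near h0 hh hy (half_pos hη)
      obtain ⟨q, hq, hq0⟩ := exists_pos_near (neg_ne_zero.2 h0) hh.neg (y := y)
        (by rw [ev_neg, hy, neg_zero]) (half_pos hη)
      rw [ev_neg, Left.neg_pos_iff] at hq0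
      have hev : ∀ x, Tendsto (fun i => ev (g i) x) atTop (𝓝 (ev h x)) := H.tendsto_ev_const
      have h1 : ∀ᶠ z in 𝓝 y, dist z y < η / 2 := Metric.ball_mem_nhds y (half_pos hη)
      have e1 : ∀ᶠ z : ℕ × Euc n in atTop ×ˢ 𝓝 y, dist z.2 y < η / 2 := tendsto_snd.eventually h1
      have e2 : ∀ᶠ z : ℕ × Euc n in atTop ×ˢ 𝓝 y, 0 < ev (g z.1) p :=
        tendsto_fst.eventually ((hev p).eventually_const_lt hp0)
      have e3 : ∀ᶠ z : ℕ × Euc n in atTop ×ˢ 𝓝 y, ev (g z.1) q < 0 :=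
        tendsto_fst.eventually ((hev q).eventually_lt_const hq0)
      filter_upwards [e1, e2, e3] with z hz1 hz2 hz3 _
      obtain ⟨w, hw, hw0⟩ := exists_ev_eq_zero_of_sign_change hp hq hz2 hz3
      refine ⟨w, hw0, ?_⟩
      have := dist_triangle_right z.2 w y
      linarith
    · filter_upwards [(tendsto_snd (f := (atTop : Filter ℕ))).eventually
        ((continuous_ev h).continuousAt.eventually_ne hy)] with q hq hq0
      exact absurd hq0 hq)
  filter_upwards [hA, hB] with i h1 h2
  exact ⟨fun a ha hn => h1 a (by simpa using hn) ha, fun b hb hn => h2 b (by simpa using hn) hb⟩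

theorem PolyTendsto.bounded {d : ℕ} {g : ℕ → MvPolynomial (Fin n) ℝ}
    {h : MvPolynomial (Fin n) ℝ} (H : PolyTendsto d g h) :
    ∃ M : ℝ, 0 ≤ M ∧ ∀ i α, |coeff α (g i)| ≤ M := by
  have h1 : ∀ α, ∃ M : ℝ, ∀ i, |coeff α (g i)| ≤ M := by
    intro α
    obtain ⟨M, hM⟩ := (H.lim α).abs.bddAbove_range
    exact ⟨M, fun i => hM ⟨i, rfl⟩⟩
  choose M hM using h1
  have hM0 : ∀ α, 0 ≤ M α := fun α => (abs_nonneg _).trans (hM α 0)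
  refine ⟨∑ α ∈ expBox n d, M α, Finset.sum_nonneg fun α _ => hM0 α, fun i α => ?_⟩
  by_cases hα : α ∈ expBox n d
  · exact (hM α i).trans (Finset.single_le_sum (fun α _ => hM0 α) hα)
  · rw [coeff_eq_zero_of_notMem_expBox (H.deg i) hα, abs_zero]
    exact Finset.sum_nonneg fun α _ => hM0 α

theorem exists_polyZeroSet_eq_hyp {p : MvPolynomial (Fin n) ℝ} (hp : p.IsHomogeneous 1)
    (h0 : p ≠ 0) : ∃ e : Euc n, ‖e‖ = 1 ∧ polyZeroSet p = hyp e := by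
  have h1 : ∀ i, ∃ c : ℝ, pderiv i p = C c := fun i =>
    ⟨_, totalDegree_eq_zero_iff_eq_C.1 (Nat.le_zero.1 (IsHomogeneous.pderiv_pred (k := 0) hp i).totalDegree_le)⟩
  choose c hc using h1
  set v : Euc n := WithLp.toLp 2 c with hv
  have hev : ∀ x, ev p x = inner ℝ v x := by
    intro x
    have h2 := hp.sum_X_mul_pderiv
    rw [one_smul] at h2
    rw [inner_eq_sum, ← h2]
    simp [ev, hc, hv, mul_comm]
  have hv0 : v ≠ 0 := by
    intro h
    apply h0
    refine eq_zero_of_ev_eq_zero fun x => ?_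
    rw [hev, h, inner_zero_left]
  refine ⟨‖v‖⁻¹ • v, by simp [norm_smul, hv0], ?_⟩
  ext x
  rw [mem_polyZeroSet, mem_hyp, hev, inner_smul_left]
  simp [hv0]

theorem pos_or_neg_of_isPreconnected {S : Set (Euc n)} (hS : IsPreconnected S) {f : Euc n → ℝ}
    (hf : Continuous f) (h0 : ∀ x ∈ S, f x ≠ 0) : (∀ x ∈ S, 0 < f x) ∨ (∀ x ∈ S, f x < 0) := by
  by_contra! H
  obtain ⟨⟨x, hx, hx0⟩, y, hy, hy0⟩ := H
  obtain ⟨z, hz, hz0⟩ := hS.intermediate_value hx hy hf.continuousOn ⟨hx0, hy0⟩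
  exact h0 z hz hz0

/-! ### Flat zero sets have a dominating linear part -/

/-- The half ball is convex, so a zero-free `h` has constant sign there, and the Hopf lemma applies
to `h` or `-h`. -/
theorem exists_linear_coeff_ne_zero_of_ne_zero {h : MvPolynomial (Fin n) ℝ} (h0 : h ≠ 0)
    (hh : IsHarmonicPoly h) (hz : ev h 0 = 0) {e : Euc n} (he : e ≠ 0)
    (hne : ∀ x : Euc n, ‖x‖ < 1 → 0 < inner ℝ e x → ev h x ≠ 0) :
    ∃ i, coeff (Finsupp.single i 1) h ≠ 0 := by
  set S : Set (Euc n) := Metric.ball 0 1 ∩ {x | 0 < inner ℝ e x} with hS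
  have hconv : Convex ℝ S := by
    refine (convex_ball 0 1).inter ?_
    exact convex_halfSpace_gt (f := fun x => inner ℝ e x) (innerₛₗ ℝ e).isLinear 0
  have hsmall : ∀ x : Euc n, 0 < inner ℝ e x → ∀ᶠ t in 𝓝[>] (0 : ℝ), t • x ∈ S := by
    intro x hx
    have hc : Tendsto (fun t : ℝ => t • x) (𝓝[>] 0) (𝓝 0) := by
      have : Continuous fun t : ℝ => t • x := by fun_prop
      simpa using (this.tendsto 0).mono_left nhdsWithin_le_nhds
    filter_upwards [hc.eventually (Metric.ball_mem_nhds 0 one_pos), self_mem_nhdsWithin] with t h1 h2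
    refine ⟨h1, ?_⟩
    change 0 < inner ℝ e (t • x)
    rw [inner_smul_right]
    exact mul_pos h2 hx
  rcases pos_or_neg_of_isPreconnected hconv.isPreconnected (continuous_ev h)
    (fun x hx => hne x (by simpa using hx.1) hx.2) with hpos | hneg
  · exact exists_linear_coeff_ne_zero h0 hh hz he fun x hx =>
      (hsmall x hx).mono fun t ht => (hpos _ ht).le
  · obtain ⟨i, hi⟩ := exists_linear_coeff_ne_zero (neg_ne_zero.2 h0) hh.neg
      (by rw [ev_neg, hz, neg_zero]) he fun x hx =>
      (hsmall x hx).mono fun t ht => by rw [ev_neg]; exact (neg_pos.2 (hneg _ ht)).le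
    exact ⟨i, by simpa using hi⟩

/-- By compactness, with flatness and dominance both failing at rate `1 / (k + 1)`: the limit has no
linear part, yet no zeros on one side of a hyperplane in the open unit ball, against the Hopf lemma.
-/
theorem exists_linear_dominates (n d : ℕ) : ∃ δ > 0, ∃ c > 0, ∀ h : MvPolynomial (Fin n) ℝ,
    h ≠ 0 → IsHarmonicPoly h → h.totalDegree ≤ d → ev h 0 = 0 → FlatSet (polyZeroSet h) δ →
      ∀ α, c * |coeff α h| ≤ ∑ i, |coeff (Finsupp.single i 1) h| := by
  by_contra! H
  have hpos : ∀ k : ℕ, (0 : ℝ) < 1 / ((k : ℝ) + 1) := fun k => by positivity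
  choose h h0 hh hd hz hflat α hα using fun k : ℕ => H _ (hpos k) _ (hpos k)
  choose e he hN using hflat
  obtain ⟨φ, hφ, c, hc, g, g0, hg⟩ := exists_polyTendsto h h0 hd
  obtain ⟨e', he', ψ, hψ, hlim⟩ := (isCompact_sphere (0 : Euc n) 1).tendsto_subseq
    (x := fun k => e (φ k)) (fun k => by simp [he])
  have hinv : Tendsto (fun k : ℕ => 1 / ((φ k : ℝ) + 1)) atTop (𝓝 0) :=
    tendsto_one_div_add_atTop_nhds_zero_nat.comp hφ.tendsto_atTop
  have gh : IsHarmonicPoly g := hg.isHarmonicPoly fun i => (hh _).smul _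
  have gz : ev g 0 = 0 := by
    have h1 := hg.lim 0
    simp only [coeff_smul, ← ev_zero_eq, hz, smul_zero] at h1
    exact tendsto_nhds_unique h1 tendsto_const_nhds
  have glin : ∀ i, coeff (Finsupp.single i 1) g = 0 := by
    obtain ⟨M, hM0, hM⟩ := hg.bounded
    have h1 : Tendsto (fun k => ∑ i, |coeff (Finsupp.single i 1) (c k • h (φ k))|) atTop
        (𝓝 (∑ i, |coeff (Finsupp.single i 1) g|)) :=
      tendsto_finsetSum _ fun i _ => (hg.lim _).abs
    have h2 : ∀ k, ∑ i, |coeff (Finsupp.single i 1) (c k • h (φ k))| ≤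
        1 / ((φ k : ℝ) + 1) * M := by
      intro k
      have h3 := hα (φ k)
      simp only [coeff_smul, smul_eq_mul, abs_mul, ← Finset.mul_sum, abs_of_pos (hc k)]
      have h4 := hM k (α (φ k))
      rw [coeff_smul, smul_eq_mul, abs_mul, abs_of_pos (hc k)] at h4
      calc c k * ∑ i, |coeff (Finsupp.single i 1) (h (φ k))|
          ≤ c k * (1 / ((φ k : ℝ) + 1) * |coeff (α (φ k)) (h (φ k))|) := by
            have := (hc k).le
            gcongr
        _ = 1 / ((φ k : ℝ) + 1) * (c k * |coeff (α (φ k)) (h (φ k))|) := by ring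
        _ ≤ _ := by gcongr
    have h3 : ∑ i, |coeff (Finsupp.single i 1) g| ≤ 0 := by
      refine le_of_tendsto_of_tendsto' h1 ?_ h2
      simpa using hinv.mul_const M
    intro i
    have h4 := (Finset.sum_eq_zero_iff_of_nonneg
      (fun i _ => abs_nonneg (coeff (Finsupp.single i 1) g))).1
      (le_antisymm h3 (Finset.sum_nonneg fun i _ => abs_nonneg _))
    simpa using h4 i (Finset.mem_univ i)
  have hne' : e' ≠ 0 := by
    rintro rfl
    simp at he'
  obtain ⟨i, hi⟩ := exists_linear_coeff_ne_zero_of_ne_zero g0 gh gz hne' (by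
    intro x hx hxe hx0
    -- `η` keeps the nearby zero of the approximant inside the unit ball, and is at most half the
    -- height of `x` above the limit hyperplane, so that flatness of the approximants is
    -- contradicted.
    set η : ℝ := min (1 - ‖x‖) (inner ℝ e' x / 2) with hη
    have hη0 : 0 < η := lt_min (by linarith) (by linarith)
    have hev : ∀ᶠ k in atTop, inner ℝ (e (φ (ψ k))) x ≤ η + 1 / ((φ (ψ k) : ℝ) + 1) := by
      filter_upwards [hψ.tendsto_atTop.eventually (hg.eventually_near g0 gh 1 hη0)] with k hk
      obtain ⟨a, ha, hd⟩ := hk.2 x hx0 hx.le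
      rw [polyZeroSet_smul (hc _).ne'] at ha
      have hna : ‖a‖ ≤ 1 := by
        have := norm_le_add_of_dist_le le_rfl hd
        have := min_le_left (1 - ‖x‖) (inner ℝ e' x / 2)
        linarith
      obtain ⟨b, hb, hd'⟩ := (hN (φ (ψ k))).1 a ha hna
      have h1 : inner ℝ (e (φ (ψ k))) x = inner ℝ (e (φ (ψ k))) (x - b) := by
        rw [inner_sub_right, mem_hyp.1 hb, sub_zero]
      rw [h1]
      refine (real_inner_le_norm _ _).trans ?_
      rw [he, one_mul, ← dist_eq_norm]
      exact (dist_triangle _ a _).trans (add_le_add hd hd')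
    have h1 : Tendsto (fun k => inner ℝ (e (φ (ψ k))) x) atTop (𝓝 (inner ℝ e' x)) :=
      hlim.inner tendsto_const_nhds
    have h2 : Tendsto (fun k => η + 1 / ((φ (ψ k) : ℝ) + 1)) atTop (𝓝 (η + 0)) :=
      (hinv.comp hψ.tendsto_atTop).const_add η
    have h3 := le_of_tendsto_of_tendsto h1 h2 hev
    have := min_le_right (1 - ‖x‖) (inner ℝ e' x / 2)
    linarith)
  exact hi (glin i)

/-- Zooming by `s` and dividing by `s` fixes the linear part and damps the terms of degree at least
2. Dominance passes to limits and keeps their linear part nonzero, so the rescaled zero sets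
approach a hyperplane; compactness makes `s` uniform in `h`. -/
theorem exists_scale_flatSet_of_linear_dominates (n d : ℕ) {c ε : ℝ} (hc : 0 < c) (hε : 0 < ε) :
    ∃ s : ℝ, 0 < s ∧ s ≤ 1 / 2 ∧ ∀ h : MvPolynomial (Fin n) ℝ,
      h ≠ 0 → IsHarmonicPoly h → h.totalDegree ≤ d → ev h 0 = 0 →
      (∀ α, c * |coeff α h| ≤ ∑ i, |coeff (Finsupp.single i 1) h|) →
      FlatSet (zoom (polyZeroSet h) 0 s) ε := by
  by_contra! H
  have hpos : ∀ k : ℕ, (0 : ℝ) < 1 / ((k : ℝ) + 1) / 2 := fun k => by positivity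
  have hle : ∀ k : ℕ, 1 / ((k : ℝ) + 1) / 2 ≤ 1 / 2 := fun k => by
    have : 1 / ((k : ℝ) + 1) ≤ 1 := by
      rw [div_le_one (by positivity)]
      linarith [Nat.cast_nonneg (α := ℝ) k]
    linarith
  choose h h0 hh hd hz hdom hnf using fun k : ℕ => H _ (hpos k) (hle k)
  obtain ⟨φ, hφ, a, ha, g, g0, hg⟩ := exists_polyTendsto h h0 hd
  set s : ℕ → ℝ := fun k => 1 / ((φ k : ℝ) + 1) / 2 with hs
  have hs0 : ∀ k, 0 < s k := fun k => hpos _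
  have hslim : Tendsto s atTop (𝓝 0) := by
    have := (tendsto_one_div_add_atTop_nhds_zero_nat (𝕜 := ℝ)).comp hφ.tendsto_atTop
    rw [hs]
    simpa [Function.comp_def] using this.div_const 2
  have gh : IsHarmonicPoly g := hg.isHarmonicPoly fun i => (hh _).smul _
  have gdom : ∀ α, c * |coeff α g| ≤ ∑ i, |coeff (Finsupp.single i 1) g| := by
    intro α
    refine le_of_tendsto_of_tendsto' ((hg.lim α).abs.const_mul c)
      (tendsto_finsetSum _ fun i _ => (hg.lim _).abs) fun k => ?_
    simp only [coeff_smul, smul_eq_mul, abs_mul, ← Finset.mul_sum, abs_of_pos (ha k)]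
    rw [mul_left_comm]
    exact mul_le_mul_of_nonneg_left (hdom _ α) (ha k).le
  have hℓ0 : homogeneousComponent 1 g ≠ 0 := by
    intro hℓ
    apply g0
    have hlin : ∀ i, coeff (Finsupp.single i 1) g = 0 := by
      intro i
      have := congrArg (coeff (Finsupp.single i 1)) hℓ
      simpa [coeff_homogeneousComponent] using this
    ext α
    have := gdom α
    simp only [hlin, abs_zero, Finset.sum_const_zero] at this
    have h2 : |coeff α g| ≤ 0 := by
      by_contra hlt
      have := mul_pos hc (not_le.1 hlt)
      linarith
    simpa using h2
  have hconv : PolyTendsto d (fun k => ((s k)⁻¹ * a k) • aff (h (φ k)) 0 (s k))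
      (homogeneousComponent 1 g) := by
    refine ⟨fun k => (totalDegree_smul_le _ _).trans ((totalDegree_aff_zero_le _ _).trans (hd _)),
      fun α => ?_⟩
    simp only [coeff_smul, coeff_aff_zero, smul_eq_mul, coeff_homogeneousComponent]
    have hl := hg.lim α
    simp only [coeff_smul, smul_eq_mul] at hl
    rcases hm : α.degree with _ | m
    · have h1 : α = 0 := (Finsupp.degree_eq_zero_iff α).1 hm
      subst h1
      simp only [← ev_zero_eq, hz]
      simp
    · have h1 : ∀ k, (s k)⁻¹ * a k * (s k ^ (m + 1) * coeff α (h (φ k))) =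
          s k ^ m * (a k * coeff α (h (φ k))) := by
        intro k
        have := (hs0 k).ne'
        field_simp
        ring
      simp only [h1]
      have h2 := (hslim.pow m).mul hl
      rcases m with _ | m
      · simpa using h2
      · simpa using h2
  obtain ⟨e, he, hZ⟩ := exists_polyZeroSet_eq_hyp (homogeneousComponent_isHomogeneous 1 g) hℓ0
  obtain ⟨k, hk⟩ := (hconv.eventually_near hℓ0 (gh.homogeneousComponent 1) 1 hε).exists
  rw [polyZeroSet_smul (mul_pos (inv_pos.2 (hs0 k)) (ha k)).ne', ← zoom_polyZeroSet, hZ] at hk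
  exact hnf (φ k) ⟨e, he, hk⟩

end

noncomputable section
open MvPolynomial

/-! ### Hyperplanes and local closeness -/

theorem hyp_mem_hyperplanes {n : ℕ} {e : Euc n} (he : ‖e‖ = 1) : hyp e ∈ hyperplanes n := by
  have he0 : e ≠ 0 := by rintro rfl; simp at he
  have hn : n ≠ 0 := by
    rintro rfl
    exact he0 (Subsingleton.elim _ _)
  obtain ⟨m, rfl⟩ := Nat.exists_eq_succ_of_ne_zero hn
  have : Fact (Module.finrank ℝ (Euc (m + 1)) = m + 1) := ⟨by simp⟩
  refine ⟨(Submodule.span ℝ {e})ᗮ, by rw [Submodule.finrank_orthogonal_span_singleton (n := m) he0], ?_⟩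
  ext z
  exact Submodule.mem_orthogonal_singleton_iff_inner_right.symm

theorem exists_eq_hyp_of_mem_hyperplanes {n : ℕ} {V : Set (Euc n)} (hV : V ∈ hyperplanes n) :
    ∃ e : Euc n, ‖e‖ = 1 ∧ V = hyp e := by
  obtain ⟨L, hL, rfl⟩ := hV
  have h1 := L.finrank_add_finrank_orthogonal
  simp only [finrank_euclideanSpace, Fintype.card_fin] at h1
  have h2 : Module.finrank ℝ Lᗮ = 1 := by omega
  obtain ⟨v, hv0, hv⟩ := finrank_eq_one_iff'.1 h2
  have hv0' : (v : Euc n) ≠ 0 := by simpa using hv0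
  refine ⟨‖(v : Euc n)‖⁻¹ • (v : Euc n), by simp [norm_smul, hv0'], ?_⟩
  ext z
  have hmem : z ∈ L ↔ ∀ u ∈ Lᗮ, inner ℝ u z = 0 := by
    rw [← Submodule.mem_orthogonal, L.orthogonal_orthogonal]
  rw [mem_hyp, inner_smul_left, SetLike.mem_coe, hmem]
  constructor
  · intro h
    rw [h v v.2, mul_zero]
  · intro h u hu
    have h3 : inner ℝ (v : Euc n) z = 0 := by simpa [hv0'] using h
    obtain ⟨c, hc⟩ := hv ⟨u, hu⟩
    have : u = c • (v : Euc n) := by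
      have := congrArg Subtype.val hc
      simpa using this.symm
    rw [this, inner_smul_left, h3, mul_zero]

variable {n : ℕ}

theorem exists_near_of_localCloseness_le {S : Set (Set (Euc n))} {A : Set (Euc n)} {x : Euc n}
    {r δ δ' : ℝ} (hr : 0 < r) (hδ : 0 ≤ δ) (hδ' : δ < δ')
    (h : localCloseness S A x r ≤ ENNReal.ofReal δ) :
    ∃ V ∈ S, Near (zoom A x r) (zoom V 0 r) 1 δ' := by
  have hr0 : ENNReal.ofReal r ≠ 0 := by simpa using hr
  have h1 : (⨅ V ∈ S, Metric.hausdorffEDist (A ∩ Metric.closedBall x r)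
    (((fun y => x + y) '' V) ∩ Metric.closedBall x r)) < ENNReal.ofReal (δ' * r) := by
    refine lt_of_le_of_lt ((ENNReal.div_le_iff hr0 ENNReal.ofReal_ne_top).1 h) ?_
    rw [← ENNReal.ofReal_mul hδ]
    exact (ENNReal.ofReal_lt_ofReal_iff (by nlinarith)).2 (by nlinarith)
  simp only [iInf_lt_iff] at h1
  obtain ⟨V, hV, hlt⟩ := h1
  have hball : ∀ a : Euc n, ‖a‖ ≤ 1 → x + r • a ∈ Metric.closedBall x r := by
    intro a ha
    rw [Metric.mem_closedBall, dist_eq_norm, add_sub_cancel_left, norm_smul,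
      Real.norm_of_nonneg hr.le]
    nlinarith
  have hdist : ∀ a b : Euc n, edist (x + r • a) b < ENNReal.ofReal (δ' * r) →
      dist a (r⁻¹ • (b - x)) ≤ δ' := by
    intro a b hab
    rw [edist_dist, ENNReal.ofReal_lt_ofReal_iff (by nlinarith)] at hab
    rw [dist_inv_smul_sub hr, div_le_iff₀ hr]
    exact hab.le
  refine ⟨V, hV, fun a ha hn => ?_, fun a ha hn => ?_⟩
  · obtain ⟨b, ⟨⟨v, hv, rfl⟩, _⟩, hb⟩ :=
      Metric.exists_edist_lt_of_hausdorffEDist_lt (show _ ∈ A ∩ _ from ⟨ha, hball a hn⟩) hlt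
    refine ⟨r⁻¹ • (x + v - x), ?_, hdist _ _ hb⟩
    rw [mem_zoom, add_sub_cancel_left, smul_smul, mul_inv_cancel₀ hr.ne', one_smul, zero_add]
    exact hv
  · rw [Metric.hausdorffEDist_comm] at hlt
    have ha' : x + r • a ∈ (fun y => x + y) '' V := by
      refine ⟨r • a, ?_, rfl⟩
      simpa [mem_zoom] using ha
    obtain ⟨b, ⟨hbA, _⟩, hb⟩ :=
      Metric.exists_edist_lt_of_hausdorffEDist_lt (show _ ∈ _ ∩ _ from ⟨ha', hball a hn⟩) hlt
    refine ⟨r⁻¹ • (b - x), ?_, hdist _ _ hb⟩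
    rwa [mem_zoom, add_smul_inv_smul_sub hr.ne']

theorem flatSet_of_localCloseness_le {A : Set (Euc n)} {x : Euc n} {r δ δ' : ℝ} (hr : 0 < r)
    (hδ : 0 ≤ δ) (hδ' : δ < δ') (h : localCloseness (hyperplanes n) A x r ≤ ENNReal.ofReal δ) :
    FlatSet (zoom A x r) δ' := by
  obtain ⟨V, hV, hN⟩ := exists_near_of_localCloseness_le hr hδ hδ' h
  obtain ⟨e, he, rfl⟩ := exists_eq_hyp_of_mem_hyperplanes hV
  rw [zoom_hyp (zero_mem_hyp e) hr.ne'] at hN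
  exact ⟨e, he, hN⟩

/-- The factor 2 pays for the truncation to the ball. A companion in the hyperplane is pulled back
by `(1 + ε)⁻¹`; for the other direction the point of the hyperplane is first shrunk by `1 - ε`. Each
costs at most `ε`. -/
theorem localCloseness_le_of_flatSet {A : Set (Euc n)} {x : Euc n} {r ε : ℝ} (hr : 0 < r)
    (hε : 0 ≤ ε) (hε1 : ε ≤ 1) (h : FlatSet (zoom A x r) ε) :
    localCloseness (hyperplanes n) A x r ≤ ENNReal.ofReal (2 * ε) := by
  obtain ⟨e, he, hN⟩ := h
  have hr0 : ENNReal.ofReal r ≠ 0 := by simpa using hr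
  unfold localCloseness
  rw [ENNReal.div_le_iff hr0 ENNReal.ofReal_ne_top, ← ENNReal.ofReal_mul (by positivity)]
  refine (iInf₂_le (hyp e) (hyp_mem_hyperplanes he)).trans ?_
  have hnorm : ∀ b : Euc n, b ∈ Metric.closedBall x r → ‖r⁻¹ • (b - x)‖ ≤ 1 := by
    intro b hb
    rw [norm_smul, norm_inv, Real.norm_of_nonneg hr.le, ← dist_eq_norm, inv_mul_le_iff₀ hr, mul_one]
    exact hb
  have hball : ∀ a : Euc n, ‖a‖ ≤ 1 → x + r • a ∈ Metric.closedBall x r := by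
    intro a ha
    rw [Metric.mem_closedBall, dist_eq_norm, add_sub_cancel_left, norm_smul,
      Real.norm_of_nonneg hr.le]
    nlinarith
  have hd : ∀ b c : Euc n, dist (r⁻¹ • (b - x)) c ≤ 2 * ε →
      edist b (x + r • c) ≤ ENNReal.ofReal (2 * ε * r) := by
    intro b c hbc
    rw [dist_comm, dist_inv_smul_sub hr, div_le_iff₀ hr, dist_comm] at hbc
    rw [edist_dist]
    exact ENNReal.ofReal_le_ofReal hbc
  refine Metric.hausdorffEDist_le_of_mem_edist ?_ ?_
  · rintro a ⟨haA, hab⟩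
    obtain ⟨b, hb, hdb⟩ := hN.1 (r⁻¹ • (a - x))
      (by rwa [mem_zoom, add_smul_inv_smul_sub hr.ne']) (hnorm a hab)
    have hb1 := norm_le_add_of_dist_le (hnorm a hab) hdb
    have hb2 : ‖(1 + ε)⁻¹ • b‖ ≤ 1 := by
      rw [norm_smul, norm_inv, Real.norm_of_nonneg (by linarith), inv_mul_le_iff₀ (by linarith)]
      linarith
    refine ⟨x + r • (1 + ε)⁻¹ • b, ⟨⟨_, smul_mem_hyp (smul_mem_hyp hb _) _, rfl⟩, hball _ hb2⟩,
      hd _ _ ?_⟩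
    have h3 : dist b ((1 + ε)⁻¹ • b) ≤ ε := by
      have : b - (1 + ε)⁻¹ • b = (ε * (1 + ε)⁻¹) • b := by
        have h4 : ε * (1 + ε)⁻¹ = 1 - (1 + ε)⁻¹ := by field_simp; ring
        rw [h4, sub_smul, one_smul]
      rw [dist_eq_norm, this, mul_smul, norm_smul, Real.norm_of_nonneg hε]
      nlinarith
    have := dist_triangle (r⁻¹ • (a - x)) b ((1 + ε)⁻¹ • b)
    linarith
  · rintro _ ⟨⟨w, hw, rfl⟩, hwb⟩
    have hw1 := hnorm _ hwb
    rw [add_sub_cancel_left] at hw1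
    set w' := r⁻¹ • w with hw'
    have hw'h : w' ∈ hyp e := smul_mem_hyp hw _
    have hn : ‖(1 - ε) • w'‖ ≤ 1 - ε := by
      rw [norm_smul, Real.norm_of_nonneg (by linarith)]
      nlinarith
    obtain ⟨a, ha, hda⟩ := hN.2 ((1 - ε) • w') (smul_mem_hyp hw'h _) (by linarith)
    have hna := norm_le_add_of_dist_le hn hda
    refine ⟨x + r • a, ⟨ha, hball _ (by linarith)⟩, hd _ _ ?_⟩
    rw [add_sub_cancel_left, ← hw']
    have h3 : dist w' ((1 - ε) • w') ≤ ε := by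
      have : w' - (1 - ε) • w' = ε • w' := by rw [sub_smul, one_smul, sub_sub_cancel]
      rw [dist_eq_norm, this, norm_smul, Real.norm_of_nonneg hε]
      nlinarith
    have := dist_triangle w' ((1 - ε) • w') a
    linarith

/-! ### Propagation of flatness -/

/-- The hyperplane direction is kept and translated from a companion `p` of `z` to `z`: one error
`ε` for the flatness and one for the shift, both divided by `s`. -/
theorem FlatSet.recenter {A : Set (Euc n)} {ε s : ℝ} (h : FlatSet A ε) (hε : ε ≤ 1 / 4)
    {z : Euc n} (hz : z ∈ A) (hz1 : ‖z‖ ≤ 1 / 4) (hs : 0 < s) (hs1 : s ≤ 1 / 2) :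
    FlatSet (zoom A z s) (2 * ε / s) := by
  obtain ⟨e, he, hN⟩ := h
  obtain ⟨p, hp, hzp⟩ := hN.1 z hz (by linarith)
  refine ⟨e, he, fun a ha hn => ?_, fun w hw hn => ?_⟩
  · have h1 : ‖z + s • a‖ ≤ 1 := by
      have := norm_add_smul_le (y := z) hs hn
      linarith
    obtain ⟨b, hb, hd⟩ := hN.1 _ ha h1
    refine ⟨s⁻¹ • (b - p + z - z), ?_, ?_⟩
    · rw [add_sub_cancel_right]
      exact smul_mem_hyp (sub_mem_hyp hb hp) _
    · rw [dist_inv_smul_sub hs]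
      gcongr
      have h2 : dist b (b - p + z) ≤ ε := by
        rw [dist_eq_norm, show b - (b - p + z) = -(z - p) by abel, norm_neg, ← dist_eq_norm]
        exact hzp
      have := dist_triangle (z + s • a) b (b - p + z)
      linarith
  · have h1 : ‖p + s • w‖ ≤ 1 := by
      have := norm_add_smul_le (y := p) hs hn
      have := norm_le_add_of_dist_le hz1 hzp
      linarith
    obtain ⟨a, ha, hd⟩ := hN.2 (p + s • w) (add_mem_hyp hp (smul_mem_hyp hw _)) h1
    refine ⟨s⁻¹ • (a - z), by rwa [mem_zoom, add_smul_inv_smul_sub hs.ne'], ?_⟩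
    rw [dist_inv_smul_sub hs]
    gcongr
    have h2 : dist (z + s • w) (p + s • w) ≤ ε := by rwa [dist_add_right]
    have := dist_triangle (z + s • w) (p + s • w) a
    linarith

theorem exists_scale_flatSet (n d : ℕ) : ∃ δ > 0, ∀ ε > 0, ∃ s : ℝ, 0 < s ∧ s ≤ 1 / 2 ∧
    ∀ h : MvPolynomial (Fin n) ℝ, h ≠ 0 → IsHarmonicPoly h → h.totalDegree ≤ d → ev h 0 = 0 →
      FlatSet (polyZeroSet h) δ → FlatSet (zoom (polyZeroSet h) 0 s) ε := by
  obtain ⟨δ, hδ, c, hc, H⟩ := exists_linear_dominates n d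
  refine ⟨δ, hδ, fun ε hε => ?_⟩
  obtain ⟨s, hs, hs1, H'⟩ := exists_scale_flatSet_of_linear_dominates n d hc hε
  exact ⟨s, hs, hs1, fun h h0 hh hd hz hf => H' h h0 hh hd hz (H h h0 hh hd hz hf)⟩

theorem exists_scale_flatSet_of_near (n d : ℕ) : ∃ δ > 0, ∀ ε > 0, ∃ s : ℝ, 0 < s ∧ s ≤ 1 / 2 ∧
    ∃ η > 0, ∀ h : MvPolynomial (Fin n) ℝ, h ≠ 0 → IsHarmonicPoly h → h.totalDegree ≤ d →
      ev h 0 = 0 → ∀ A : Set (Euc n), Near A (polyZeroSet h) 1 η → FlatSet A δ →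
        FlatSet (zoom A 0 s) ε := by
  obtain ⟨δ, hδ, H⟩ := exists_scale_flatSet n d
  refine ⟨min (δ / 4) (1 / 4), by positivity, fun ε hε => ?_⟩
  set ε₁ := min ε 1 with hε₁
  have hε₁0 : 0 < ε₁ := by positivity
  obtain ⟨s, hs, hs1, H'⟩ := H (ε₁ / 4) (by positivity)
  have hη0 : 0 < min (min (δ / 4) (1 / 4)) (s * ε₁ / 8) := by positivity
  -- `s / 4 = (1 / 2) * s * (1 / 2)`: half the radius is given up in each of the two comparisons
  -- between `A` and the zero set.
  refine ⟨s / 4, by positivity, by linarith, min (min (δ / 4) (1 / 4)) (s * ε₁ / 8), hη0,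
    fun h h0 hh hd hz A hA hflat => ?_⟩
  set η := min (min (δ / 4) (1 / 4)) (s * ε₁ / 8)
  have e1 : η ≤ δ / 4 := (min_le_left _ _).trans (min_le_left _ _)
  have e2 : η ≤ 1 / 4 := (min_le_left _ _).trans (min_le_right _ _)
  have e3 : η ≤ s * ε₁ / 8 := min_le_right _ _
  have e4 : min (δ / 4) (1 / 4) ≤ δ / 4 := min_le_left _ _
  have e5 : min (δ / 4) (1 / 4) ≤ 1 / 4 := min_le_right _ _
  have e6 : ε₁ ≤ 1 := min_le_right _ _
  have e7 : ε₁ ≤ ε := min_le_left _ _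
  obtain ⟨e, he, hN⟩ := hflat
  have hN1 : Near (polyZeroSet h) (hyp e) (1 / 2) (η + min (δ / 4) (1 / 4)) :=
    hA.symm.trans hN (by norm_num) (by norm_num) (by linarith) (by linarith)
  have hN2 := hN1.zoom 0 (s := 1 / 2) (R' := 1) (by norm_num) (by simp)
  rw [zoom_hyp (zero_mem_hyp e) (by norm_num)] at hN2
  have hfl : FlatSet (polyZeroSet (aff h 0 (1 / 2))) δ := by
    rw [← zoom_polyZeroSet]
    refine ⟨e, he, hN2.mono le_rfl ?_⟩
    rw [div_le_iff₀ (by norm_num)]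
    linarith
  obtain ⟨e', he', hN3⟩ := H' (aff h 0 (1 / 2)) (aff_ne_zero h0 _ (by norm_num)) (hh.aff _ _)
    ((totalDegree_aff_zero_le _ _).trans hd) (by rw [ev_aff]; simpa using hz) hfl
  rw [← zoom_polyZeroSet, zoom_zoom, smul_zero, add_zero] at hN3
  have hN4 := hA.zoom 0 (s := 1 / 2 * s) (R' := 1) (by positivity) (by simp; linarith)
  have e8 : η / (1 / 2 * s) ≤ ε₁ / 4 := by
    rw [div_le_iff₀ (by positivity)]
    linarith
  have hN5 : Near (zoom A 0 (1 / 2 * s)) (hyp e') (1 / 2) (η / (1 / 2 * s) + ε₁ / 4) :=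
    hN4.trans hN3 (by norm_num) (by norm_num) (by linarith) (by linarith)
  have hN6 := hN5.zoom 0 (s := 1 / 2) (R' := 1) (by norm_num) (by simp)
  rw [zoom_hyp (zero_mem_hyp e') (by norm_num), zoom_zoom, smul_zero, add_zero,
    show 1 / 2 * s * (1 / 2) = s / 4 by ring] at hN6
  refine ⟨e', he', hN6.mono le_rfl ?_⟩
  rw [div_le_iff₀ (by norm_num)]
  linarith

/-- The polynomials whose zero sets form the class `H_d`. -/
def IsAdmissible (d : ℕ) (h : MvPolynomial (Fin n) ℝ) : Prop :=
  h ≠ 0 ∧ IsHarmonicPoly h ∧ h.totalDegree ≤ d ∧ ev h 0 = 0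

theorem exists_admissible_near {d : ℕ} {Γ : Set (Euc n)}
    (happrox : LocallyWellApproximated (harmonicZeroSets n d) Γ) {K : Set (Euc n)}
    (hK : IsCompact K) (hKΓ : K ⊆ Γ) {η : ℝ} (hη : 0 < η) :
    ∃ r₀ : ℝ, 0 < r₀ ∧ ∀ x ∈ K, ∀ r : ℝ, 0 < r → r ≤ r₀ →
      ∃ h, IsAdmissible d h ∧ Near (zoom Γ x r) (polyZeroSet h) 1 η := by
  obtain ⟨r₀, hr₀, H⟩ := happrox (η / 2) (half_pos hη) K hK hKΓ
  refine ⟨r₀, hr₀, fun x hx r hr hrr => ?_⟩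
  obtain ⟨V, ⟨h, hh, h1, hd, hz, rfl⟩, hN⟩ :=
    exists_near_of_localCloseness_le hr (half_pos hη).le (half_lt_self hη) (H x hx r hr hrr)
  have h0 : h ≠ 0 := by rintro rfl; simp at h1
  rw [zoom_polyZeroSet] at hN
  exact ⟨_, ⟨aff_ne_zero h0 _ hr.ne', hh.aff _ _, (totalDegree_aff_zero_le _ _).trans hd,
    by rw [ev_aff]; simpa [mem_polyZeroSet] using hz⟩, hN⟩

/-- The factor `s` is chosen before `K`, since the flatness threshold in `exists_flat_propagation`
depends on `s` but not on `K`. -/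
theorem exists_flat_step {d : ℕ} {Γ : Set (Euc n)}
    (happrox : LocallyWellApproximated (harmonicZeroSets n d) Γ) :
    ∃ δ > 0, ∀ ε > 0, ∃ s : ℝ, 0 < s ∧ s ≤ 1 / 2 ∧ ∀ K : Set (Euc n), IsCompact K → K ⊆ Γ →
      ∃ r₀ : ℝ, 0 < r₀ ∧ ∀ y ∈ K, ∀ r : ℝ, 0 < r → r ≤ r₀ → FlatSet (zoom Γ y r) δ →
        FlatSet (zoom Γ y (r * s)) ε := by
  obtain ⟨δ, hδ, H⟩ := exists_scale_flatSet_of_near n d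
  refine ⟨δ, hδ, fun ε hε => ?_⟩
  obtain ⟨s, hs, hs1, η, hη, H'⟩ := H ε hε
  refine ⟨s, hs, hs1, fun K hK hKΓ => ?_⟩
  obtain ⟨r₀, hr₀, H''⟩ := exists_admissible_near happrox hK hKΓ hη
  refine ⟨r₀, hr₀, fun y hy r hr hrr hf => ?_⟩
  obtain ⟨h, ⟨h0, hh, hd, hz⟩, hN⟩ := H'' y hy r hr hrr
  have := H' h h0 hh hd hz _ hN hf
  rwa [zoom_zoom, smul_zero, add_zero] at this

/-- Recentering gives `δ`-flatness at `y` for scales in `(s r / 2, r / 2]`. The step with target `δ`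
carries it down by factors `s` to all scales, and one further step with target `ε` upgrades it. All
constants are independent of `y`. -/
theorem exists_flat_propagation {d : ℕ} {Γ : Set (Euc n)}
    (happrox : LocallyWellApproximated (harmonicZeroSets n d) Γ) :
    ∃ δ > 0, ∀ K : Set (Euc n), IsCompact K → K ⊆ Γ → ∃ r₀ : ℝ, 0 < r₀ ∧
      ∀ x r, 0 < r → r ≤ r₀ → FlatSet (zoom Γ x r) δ → ∀ ε > 0, ∃ t₀ : ℝ, 0 < t₀ ∧
        ∀ y ∈ K, dist y x ≤ r / 4 → ∀ t : ℝ, 0 < t → t ≤ t₀ → FlatSet (zoom Γ y t) ε := by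
  obtain ⟨δ, hδ, H⟩ := exists_flat_step happrox
  obtain ⟨s, hs, hs1, Hs⟩ := H δ hδ
  -- With `t / r > s / 2`, the recentered error `2 (δ s / 4) / (t / r)` is at most `δ`.
  refine ⟨min (δ * s / 4) (1 / 4), by positivity, fun K hK hKΓ => ?_⟩
  obtain ⟨r₀, hr₀, H'⟩ := Hs K hK hKΓ
  refine ⟨r₀, hr₀, fun x r hr hrr hflat ε hε => ?_⟩
  obtain ⟨σ, hσ, hσ1, Hσ⟩ := H ε hε
  obtain ⟨r₁, hr₁, H''⟩ := Hσ K hK hKΓ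
  refine ⟨σ * min (r / 2) r₁, by positivity, fun y hy hyx => ?_⟩
  set z := r⁻¹ • (y - x) with hz
  have hyz : x + r • z = y := add_smul_inv_smul_sub hr.ne'
  have hzn : ‖z‖ ≤ 1 / 4 := by
    rw [hz, norm_smul, norm_inv, Real.norm_of_nonneg hr.le, ← dist_eq_norm, inv_mul_le_iff₀ hr]
    linarith
  have hzA : z ∈ zoom Γ x r := by
    rw [mem_zoom, hyz]
    exact hKΓ hy
  have hbase : ∀ t, s * r / 2 < t → t ≤ r / 2 → FlatSet (zoom Γ y t) δ := by
    intro t ht1 ht2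
    have ht0 : 0 < t := lt_trans (by positivity) ht1
    have h1 := hflat.recenter (min_le_right _ _) hzA hzn (s := t / r) (by positivity)
      (by rw [div_le_iff₀ hr]; linarith)
    rw [zoom_zoom, hyz, mul_div_cancel₀ _ hr.ne'] at h1
    refine h1.mono ?_
    rw [div_le_iff₀ (by positivity)]
    have h2 : min (δ * s / 4) (1 / 4) ≤ δ * s / 4 := min_le_left _ _
    have h3 : s / 2 < t / r := by rw [lt_div_iff₀ hr]; linarith
    nlinarith
  have hall : ∀ k : ℕ, ∀ t, s ^ k * (s * r / 2) < t → t ≤ r / 2 → FlatSet (zoom Γ y t) δ := by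
    intro k
    induction k with
    | zero => simpa using hbase
    | succ k ih =>
      intro t ht1 ht2
      by_cases hlt : s * r / 2 < t
      · exact hbase t hlt ht2
      · have ht0 : 0 < t := lt_trans (by positivity) ht1
        have h1 : t / s ≤ r / 2 := by rw [div_le_iff₀ hs]; linarith
        have h2 := ih (t / s) (by rw [lt_div_iff₀ hs]; rw [pow_succ] at ht1; linarith) h1
        have h3 := H' y hy (t / s) (by positivity) (by linarith) h2
        rwa [div_mul_cancel₀ _ hs.ne'] at h3
  have hδall : ∀ t, 0 < t → t ≤ r / 2 → FlatSet (zoom Γ y t) δ := by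
    intro t ht0 ht
    obtain ⟨k, hk⟩ := exists_pow_lt_of_lt_one (show 0 < t / (s * r / 2) by positivity)
      (show s < 1 by linarith)
    exact hall k t (by rwa [lt_div_iff₀ (by positivity)] at hk) ht
  intro t ht0 ht
  have h1 : t / σ ≤ min (r / 2) r₁ := by
    rw [div_le_iff₀ hσ, mul_comm]
    exact ht
  have h2 := H'' y hy (t / σ) (by positivity) (h1.trans (min_le_right _ _))
    (hδall _ (by positivity) (h1.trans (min_le_left _ _)))
  rwa [div_mul_cancel₀ _ hσ.ne'] at h2

/-- Near `x`, the set `Γ` is uniformly flat at all small scales. -/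
def UniformlyFlatNear (Γ : Set (Euc n)) (x : Euc n) (ρ : ℝ) : Prop :=
  0 < ρ ∧ ∀ ε > 0, ∃ t₀ : ℝ, 0 < t₀ ∧ ∀ y ∈ Γ, dist y x ≤ ρ → ∀ t : ℝ, 0 < t → t ≤ t₀ →
    FlatSet (zoom Γ y t) ε

/-- The scale `r₀` serves all centres within distance 1 of `p`, so it can be fixed before the centre
is found, and the centre need not be known to lie in `Γ`. -/
theorem exists_uniformlyFlatNear {d : ℕ} {Γ : Set (Euc n)} (hΓ : IsClosed Γ)
    (happrox : LocallyWellApproximated (harmonicZeroSets n d) Γ) :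
    ∃ δ > 0, ∀ p : Euc n, ∃ r₀ : ℝ, 0 < r₀ ∧ ∀ x r, dist x p ≤ 1 → 0 < r → r ≤ r₀ →
      FlatSet (zoom Γ x r) δ → ∃ ρ, UniformlyFlatNear Γ x ρ := by
  obtain ⟨δ, hδ, H⟩ := exists_flat_propagation happrox
  refine ⟨δ, hδ, fun p => ?_⟩
  obtain ⟨r₀, hr₀, H'⟩ := H (Γ ∩ Metric.closedBall p 2) ((isCompact_closedBall p 2).inter_left hΓ)
    inter_subset_left
  refine ⟨r₀, hr₀, fun x r hx hr hrr hf => ⟨min (r / 4) 1, by positivity, fun ε hε => ?_⟩⟩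
  obtain ⟨t₀, ht₀, H''⟩ := H' x r hr hrr hf ε hε
  refine ⟨t₀, ht₀, fun y hy hyx => H'' y ⟨hy, ?_⟩ (hyx.trans (min_le_left _ _))⟩
  have h1 := hyx.trans (min_le_right _ _)
  have := dist_triangle y x p
  rw [Metric.mem_closedBall]
  linarith

theorem UniformlyFlatNear.mem_flatPoints {Γ : Set (Euc n)} {x y : Euc n} {ρ : ℝ}
    (h : UniformlyFlatNear Γ x ρ) (hy : y ∈ Γ) (hyx : dist y x ≤ ρ) : y ∈ flatPoints Γ := by
  refine ⟨hy, ?_⟩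
  rw [ENNReal.tendsto_nhds_zero]
  intro ε hε
  obtain ⟨ε', hε'0, hε'⟩ : ∃ ε' : ℝ, 0 < ε' ∧ ENNReal.ofReal (2 * ε') ≤ ε ∧ ε' ≤ 1 := by
    rcases eq_or_ne ε ⊤ with rfl | htop
    · exact ⟨1, one_pos, le_top, le_rfl⟩
    · refine ⟨min (ε.toReal / 2) 1, ?_, ?_, min_le_right _ _⟩
      · have := ENNReal.toReal_pos hε.ne' htop
        positivity
      · rw [ENNReal.ofReal_le_iff_le_toReal htop]
        have := min_le_left (ε.toReal / 2) 1
        linarith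
  obtain ⟨t₀, ht₀, H⟩ := h.2 ε' hε'0
  filter_upwards [Ioc_mem_nhdsGT ht₀] with t ht
  exact (localCloseness_le_of_flatSet ht.1 hε'0.le hε'.2 (H y hy hyx t ht.1 ht.2)).trans hε'.1

theorem exists_uniformlyFlatNear_of_mem_flatPoints {d : ℕ} {Γ : Set (Euc n)} (hΓ : IsClosed Γ)
    (happrox : LocallyWellApproximated (harmonicZeroSets n d) Γ) {x : Euc n}
    (hx : x ∈ flatPoints Γ) : ∃ ρ, UniformlyFlatNear Γ x ρ := by
  obtain ⟨δ, hδ, H⟩ := exists_uniformlyFlatNear hΓ happrox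
  obtain ⟨r₀, hr₀, H'⟩ := H x
  have h1 := (ENNReal.tendsto_nhds_zero.1 hx.2) (ENNReal.ofReal (δ / 2)) (by simpa using hδ)
  obtain ⟨r, hr, hr2⟩ := (h1.and (Ioc_mem_nhdsGT hr₀)).exists
  exact H' x r (by simp) hr2.1 hr2.2
    (flatSet_of_localCloseness_le hr2.1 (half_pos hδ).le (half_lt_self hδ) hr)

end

noncomputable section
open MvPolynomial

variable {n : ℕ}

/-! ### Existence of flat points -/

/-- The zero set of a harmonic polynomial contains regular points: the first zeros met by a
growing ball. -/
theorem exists_regular_zero {h : MvPolynomial (Fin n) ℝ} (h0 : h ≠ 0) (hh : IsHarmonicPoly h)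
    (hz : ev h 0 = 0) {ε : ℝ} (hε : 0 < ε) :
    ∃ y, ‖y‖ ≤ ε ∧ ev h y = 0 ∧ ∃ i, coeff (Finsupp.single i 1) (aff h y 1) ≠ 0 := by
  obtain ⟨a, ha, ha0⟩ := exists_pos_near h0 hh hz (half_pos hε)
  rw [dist_zero_right] at ha
  -- `y` is a nearest zero to a point `a` with `h a > 0`, so `h` is positive on the open ball about
  -- `a` that touches the zero set at `y`.
  obtain ⟨y, hy, hya⟩ := (isClosed_polyZeroSet h).exists_infDist_eq_dist ⟨0, hz⟩ a
  have hle : dist a y ≤ ‖a‖ := by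
    rw [← hya, ← dist_zero_right]
    exact Metric.infDist_le_dist_of_mem hz
  have hya0 : a - y ≠ 0 := by
    intro h1
    rw [sub_eq_zero.1 h1] at ha0
    exact ha0.ne' hy
  refine ⟨y, ?_, hy, ?_⟩
  · have := norm_le_add_of_dist_le ha.le hle
    linarith
  · have hpos : ∀ x ∈ Metric.ball a (dist a y), 0 < ev h x := by
      rcases pos_or_neg_of_isPreconnected (convex_ball a (dist a y)).isPreconnected
        (continuous_ev h) (fun x hx hx0 => by
          have h1 := Metric.infDist_le_dist_of_mem (x := a) (s := polyZeroSet h) hx0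
          rw [hya] at h1
          rw [Metric.mem_ball, dist_comm] at hx
          linarith) with h1 | h1
      · exact h1
      · have := h1 a (Metric.mem_ball_self (by rw [dist_eq_norm]; exact norm_pos_iff.2 hya0))
        linarith
    refine exists_linear_coeff_ne_zero (aff_ne_zero h0 y one_ne_zero) (hh.aff y 1)
      (by rw [ev_aff]; simpa [mem_polyZeroSet] using hy) hya0 fun x hx => ?_
    have hx0 : 0 < ‖x‖ ^ 2 := by
      have : x ≠ 0 := by rintro rfl; simp at hx
      positivity
    -- For these `t` the point `y + t x` is inside that ball: `‖a - y - t x‖ < ‖a - y‖` amounts to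
    -- `t ‖x‖² < 2 ⟪a - y, x⟫`.
    filter_upwards [Ioo_mem_nhdsGT (show 0 < 2 * inner ℝ (a - y) x / ‖x‖ ^ 2 by positivity)]
      with t ht
    rw [ev_aff, one_smul]
    refine (hpos _ ?_).le
    rw [Metric.mem_ball, dist_comm, dist_eq_norm, dist_eq_norm]
    refine lt_of_pow_lt_pow_left₀ 2 (norm_nonneg _) ?_
    rw [← sub_sub, norm_sub_sq_real, inner_smul_right, norm_smul, mul_pow, Real.norm_eq_abs, sq_abs]
    have h1 := (lt_div_iff₀ hx0).1 ht.2
    have := ht.1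
    nlinarith

/-- For a single polynomial a nonzero linear part dominates with some constant; no uniformity in `h`
is needed here. -/
theorem exists_flatSet_zoom_of_regular {h : MvPolynomial (Fin n) ℝ} (h0 : h ≠ 0)
    (hh : IsHarmonicPoly h) {y : Euc n} (hy : ev h y = 0)
    (hreg : ∃ i, coeff (Finsupp.single i 1) (aff h y 1) ≠ 0) {ε : ℝ} (hε : 0 < ε) :
    ∃ s : ℝ, 0 < s ∧ s ≤ 1 / 2 ∧ FlatSet (zoom (polyZeroSet h) y s) ε := by
  set g := aff h y 1
  set N := ∑ i, |coeff (Finsupp.single i 1) g|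
  have hN : 0 < N := by
    obtain ⟨i, hi⟩ := hreg
    exact Finset.sum_pos' (fun i _ => abs_nonneg _) ⟨i, Finset.mem_univ i, abs_pos.2 hi⟩
  set M := 1 + ∑ α ∈ g.support, |coeff α g|
  have hsum : 0 ≤ ∑ α ∈ g.support, |coeff α g| := Finset.sum_nonneg fun _ _ => abs_nonneg _
  have hM : 0 < M := by positivity
  have hdom : ∀ α, N / M * |coeff α g| ≤ N := by
    intro α
    have h1 : |coeff α g| ≤ M := by
      by_cases hα : α ∈ g.support
      · have := Finset.single_le_sum (f := fun α => |coeff α g|) (fun _ _ => abs_nonneg _) hα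
        simp only [M]
        linarith
      · rw [notMem_support_iff.1 hα, abs_zero]
        exact hM.le
    rw [div_mul_eq_mul_div, div_le_iff₀ hM]
    gcongr
  obtain ⟨s, hs, hs1, H⟩ :=
    exists_scale_flatSet_of_linear_dominates n g.totalDegree (div_pos hN hM) hε
  refine ⟨s, hs, hs1, ?_⟩
  have := H g (aff_ne_zero h0 y one_ne_zero) (hh.aff y 1) le_rfl
    (by rw [ev_aff]; simpa using hy) hdom
  rwa [← zoom_polyZeroSet, zoom_zoom, smul_zero, add_zero, one_mul] at this

/-- Polynomials approximating `Γ` at `x₀` subconverge to some `g`. Near a regular zero of `g` its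
zero set is very flat, so `Γ`, at a suitable scale, is `δ`-flat around one of its own points. -/
theorem exists_mem_uniformlyFlatNear {d : ℕ} {Γ : Set (Euc n)} (hΓ : IsClosed Γ)
    (happrox : LocallyWellApproximated (harmonicZeroSets n d) Γ) (hne : Γ.Nonempty) :
    ∃ x ∈ Γ, ∃ ρ, UniformlyFlatNear Γ x ρ := by
  obtain ⟨x₀, hx₀⟩ := hne
  obtain ⟨δ, hδ, H⟩ := exists_uniformlyFlatNear hΓ happrox
  obtain ⟨r₀, hr₀, H'⟩ := H x₀
  have hpos : ∀ k : ℕ, (0 : ℝ) < 1 / ((k : ℝ) + 1) := fun k => by positivity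
  choose ρ hρ hap using fun k : ℕ => exists_admissible_near happrox
    (isCompact_singleton (x := x₀)) (by simpa using hx₀) (hpos k)
  set r : ℕ → ℝ := fun k => min (ρ k) (min r₀ 1) with hr
  have hr1 : ∀ k, 0 < r k := fun k => lt_min (hρ k) (lt_min hr₀ one_pos)
  choose h had hN using fun k => hap k x₀ rfl (r k) (hr1 k) (min_le_left _ _)
  obtain ⟨φ, hφ, c, hc, g, g0, hg⟩ :=
    exists_polyTendsto h (fun k => (had k).1) (fun k => (had k).2.2.1)
  have gh : IsHarmonicPoly g := hg.isHarmonicPoly fun i => (had _).2.1.smul _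
  have gz : ev g 0 = 0 := by
    have h1 := hg.lim 0
    simp only [coeff_smul, ← ev_zero_eq, (had _).2.2.2, smul_zero] at h1
    exact tendsto_nhds_unique h1 tendsto_const_nhds
  obtain ⟨y, hy, hy0, hreg⟩ := exists_regular_zero g0 gh gz (show (0 : ℝ) < 1 / 4 by norm_num)
  -- Error budget: comparing with `Γ` and halving the radius gives `3 ε`, and recentering at scale
  -- `1 / 2` multiplies by 4.
  set ε : ℝ := min δ 1 / 12 with hε
  have hε0 : 0 < ε := by positivity
  have hε1 : ε ≤ 1 / 12 := by
    have := min_le_right δ 1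
    linarith
  have hεδ : 12 * ε ≤ δ := by
    have := min_le_left δ 1
    linarith
  obtain ⟨s, hs, hs1, e, he, hflat⟩ := exists_flatSet_zoom_of_regular g0 gh hy0 hreg hε0
  -- Two errors `η`, divided by the zoom factor `s`, make `ε / 2`.
  set η : ℝ := s * ε / 4 with hη
  have hη0 : 0 < η := by positivity
  have hη1 : η ≤ 1 / 96 := by nlinarith
  have hinv : Tendsto (fun k : ℕ => 1 / ((φ k : ℝ) + 1)) atTop (𝓝 0) :=
    tendsto_one_div_add_atTop_nhds_zero_nat.comp hφ.tendsto_atTop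
  obtain ⟨k, hk1, hk2⟩ :=
    ((hg.eventually_near g0 gh 1 hη0).and (hinv.eventually_le_const hη0)).exists
  rw [polyZeroSet_smul (hc k).ne'] at hk1
  have hN1 : Near (zoom Γ x₀ (r (φ k))) (polyZeroSet g) (7 / 8) (η + η) :=
    ((hN (φ k)).mono le_rfl hk2).trans hk1 (by norm_num) (by norm_num) (by linarith) (by linarith)
  obtain ⟨y', hy', hd⟩ := hN1.2 y hy0 (by linarith)
  have hN2 := hN1.zoom y hs (R' := 1) (by linarith)
  have e1 : (η + η) / s = ε / 2 := by
    rw [hη]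
    field_simp
    ring
  rw [e1] at hN2
  have hN3 : Near (zoom (zoom Γ x₀ (r (φ k))) y s) (hyp e) (1 / 2) (ε / 2 + ε) :=
    hN2.trans hflat (by norm_num) (by norm_num) (by linarith) (by linarith)
  have hN4 := hN3.zoom 0 (s := 1 / 2) (R' := 1) (by norm_num) (by simp)
  rw [zoom_hyp (zero_mem_hyp e) (by norm_num), zoom_zoom, smul_zero, add_zero] at hN4
  have hF : FlatSet (zoom (zoom Γ x₀ (r (φ k))) y (s * (1 / 2))) (3 * ε) :=
    ⟨e, he, hN4.mono le_rfl (by rw [div_le_iff₀ (by norm_num)]; linarith)⟩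
  have hs2 : 0 < s * (1 / 2) := by positivity
  set z := (s * (1 / 2))⁻¹ • (y' - y) with hz
  have hyz : y + (s * (1 / 2)) • z = y' := add_smul_inv_smul_sub hs2.ne'
  have hzn : ‖z‖ ≤ 1 / 4 := by
    rw [hz, norm_smul, norm_inv, Real.norm_of_nonneg hs2.le, ← dist_eq_norm,
      inv_mul_le_iff₀ hs2, dist_comm]
    refine hd.trans ?_
    rw [hη]
    nlinarith
  have hF2 := hF.recenter (by linarith) (z := z) (by rwa [mem_zoom, hyz]) hzn
    (s := 1 / 2) (by norm_num) le_rfl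
  rw [zoom_zoom, hyz, zoom_zoom] at hF2
  have hy'n : ‖y'‖ ≤ 1 := by
    have := norm_le_add_of_dist_le hy hd
    linarith
  have hr2 : r (φ k) ≤ 1 := (min_le_right _ _).trans (min_le_right _ _)
  have hr3 : r (φ k) ≤ r₀ := (min_le_right _ _).trans (min_le_left _ _)
  have hrp := hr1 (φ k)
  refine ⟨x₀ + r (φ k) • y', hy', H' _ _ ?_ ?_ ?_ (hF2.mono ?_)⟩
  · rw [dist_eq_norm, add_sub_cancel_left, norm_smul, Real.norm_of_nonneg hrp.le]
    exact mul_le_one₀ hr2 (norm_nonneg _) hy'n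
  · positivity
  · nlinarith
  · rw [div_le_iff₀ (by norm_num)]
    linarith

end

noncomputable section
open MeasureTheory

/-! ### Self-similar coverings and the upper bound for the dimension -/

section Covering

variable {X : Type*} [MetricSpace X]

theorem exists_iterated_cover {K : Set X} {N : ℕ} {ρ t₀ : ℝ} (hρ : 0 < ρ) (hρ1 : ρ ≤ 1)
    (H : ∀ y ∈ K, ∀ t, 0 < t → t ≤ t₀ → ∃ S : Finset X, S.card ≤ N ∧ (S : Set X) ⊆ K ∧
      K ∩ Metric.closedBall y t ⊆ ⋃ z ∈ S, Metric.closedBall z (ρ * t))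
    {y : X} (hy : y ∈ K) {t : ℝ} (ht : 0 < t) (htt : t ≤ t₀) (p : ℕ) :
    ∃ S : Finset X, S.card ≤ N ^ p ∧ (S : Set X) ⊆ K ∧
      K ∩ Metric.closedBall y t ⊆ ⋃ z ∈ S, Metric.closedBall z (ρ ^ p * t) := by
  classical
  induction p with
  | zero => exact ⟨{y}, by simp, by simpa using hy, by simp⟩
  | succ p ih =>
    obtain ⟨S, hS, hSK, hcov⟩ := ih
    have hsc : ρ ^ p * t ≤ t₀ :=
      (mul_le_of_le_one_left ht.le (pow_le_one₀ hρ.le hρ1)).trans htt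
    choose! F hF using fun (z : X) (hz : z ∈ K) => H z hz (ρ ^ p * t) (by positivity) hsc
    refine ⟨S.biUnion F, ?_, ?_, ?_⟩
    · refine (Finset.card_biUnion_le_card_mul S F N fun z hz => (hF z (hSK hz)).1).trans ?_
      rw [pow_succ]
      gcongr
    · intro w hw
      simp only [Finset.coe_biUnion, mem_iUnion] at hw
      obtain ⟨z, hz, hwz⟩ := hw
      exact (hF z (hSK hz)).2.1 hwz
    · intro w hw
      obtain ⟨z, hz, hwz⟩ := mem_iUnion₂.1 (hcov hw)
      obtain ⟨v, hv, hwv⟩ := mem_iUnion₂.1 ((hF z (hSK hz)).2.2 ⟨hw.1, hwz⟩)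
      refine mem_iUnion₂.2 ⟨v, Finset.mem_biUnion.2 ⟨z, hz, hv⟩, ?_⟩
      rwa [pow_succ', mul_assoc]

/-- Since the centres stay in `K`, the covering iterates: `N ^ p` balls of radius `ρ ^ p t`, whose
`s`-sums are bounded by a multiple of `(N ρ ^ s) ^ p` and tend to zero. -/
theorem dimH_inter_closedBall_le_of_cover {K : Set X} {N : ℕ} {ρ t₀ : ℝ} (hρ : 0 < ρ) (hρ1 : ρ < 1)
    (H : ∀ y ∈ K, ∀ t, 0 < t → t ≤ t₀ → ∃ S : Finset X, S.card ≤ N ∧ (S : Set X) ⊆ K ∧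
      K ∩ Metric.closedBall y t ⊆ ⋃ z ∈ S, Metric.closedBall z (ρ * t))
    {s : NNReal} (hs : N * ρ ^ (s : ℝ) < 1)
    {y : X} (hy : y ∈ K) {t : ℝ} (ht : 0 < t) (htt : t ≤ t₀) :
    dimH (K ∩ Metric.closedBall y t) ≤ s := by
  borelize X
  refine dimH_le_of_hausdorffMeasure_ne_top ?_
  choose S hS _ hcov using exists_iterated_cover hρ hρ1.le H hy ht htt
  have hdiam : ∀ p (z : X), Metric.ediam (Metric.closedBall z (ρ ^ p * t)) ≤
      ENNReal.ofReal (2 * (ρ ^ p * t)) := by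
    intro p z
    refine Metric.ediam_le fun a ha b hb => ?_
    rw [edist_dist]
    refine ENNReal.ofReal_le_ofReal ?_
    have := dist_triangle_right a b z
    rw [Metric.mem_closedBall] at ha hb
    linarith
  have h1 : Tendsto (fun p : ℕ => ENNReal.ofReal (2 * (ρ ^ p * t))) atTop (𝓝 0) := by
    have := ((tendsto_pow_atTop_nhds_zero_of_lt_one hρ.le hρ1).mul_const t).const_mul 2
    simpa using ENNReal.tendsto_ofReal this
  have h2 := Measure.hausdorffMeasure_le_liminf_sum (ι := fun p => S p) (s : ℝ)
    (K ∩ Metric.closedBall y t) (fun p : ℕ => ENNReal.ofReal (2 * (ρ ^ p * t))) h1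
    (fun p z => Metric.closedBall (z : X) (ρ ^ p * t))
    (Eventually.of_forall fun p z => hdiam p z)
    (Eventually.of_forall fun p => by
      refine (hcov p).trans ?_
      intro w hw
      obtain ⟨z, hz, hwz⟩ := mem_iUnion₂.1 hw
      exact mem_iUnion.2 ⟨⟨z, hz⟩, hwz⟩)
  have h3 : ∀ p, ∑ z : S p, Metric.ediam (Metric.closedBall (z : X) (ρ ^ p * t)) ^ (s : ℝ) ≤
      ENNReal.ofReal ((2 * t) ^ (s : ℝ) * (N * ρ ^ (s : ℝ)) ^ p) := by
    intro p
    calc ∑ z : S p, Metric.ediam (Metric.closedBall (z : X) (ρ ^ p * t)) ^ (s : ℝ)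
        ≤ ∑ z : S p, ENNReal.ofReal (2 * (ρ ^ p * t)) ^ (s : ℝ) := by
          gcongr with z _
          exact hdiam p z
      _ = (S p).card * ENNReal.ofReal (2 * (ρ ^ p * t)) ^ (s : ℝ) := by simp
      _ ≤ ((N ^ p : ℕ) : ℝ≥0∞) * ENNReal.ofReal (2 * (ρ ^ p * t)) ^ (s : ℝ) := by
          gcongr
          exact hS p
      _ = _ := by
          rw [ENNReal.ofReal_rpow_of_nonneg (by positivity) s.coe_nonneg, ← ENNReal.ofReal_natCast,
            ← ENNReal.ofReal_mul (by positivity)]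
          congr 1
          rw [show 2 * (ρ ^ p * t) = 2 * t * ρ ^ p by ring,
            Real.mul_rpow (by positivity) (by positivity), mul_pow, ← Real.rpow_natCast ρ p,
            ← Real.rpow_mul hρ.le, mul_comm (p : ℝ), Real.rpow_mul hρ.le, Real.rpow_natCast]
          push_cast
          ring
  have h4 : Tendsto (fun p : ℕ => ENNReal.ofReal ((2 * t) ^ (s : ℝ) * (N * ρ ^ (s : ℝ)) ^ p))
      atTop (𝓝 0) := by
    have := (tendsto_pow_atTop_nhds_zero_of_lt_one (by positivity) hs).const_mul
      ((2 * t) ^ (s : ℝ))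
    simpa using ENNReal.tendsto_ofReal this
  have h5 := h2.trans (liminf_le_liminf (Eventually.of_forall h3))
  rw [h4.liminf_eq] at h5
  exact ne_top_of_le_ne_top ENNReal.zero_ne_top h5

end Covering

/-! ### Cantor sets and the lower bound for the dimension -/

section Cantor

variable {X : Type*} [MetricSpace X] [CompleteSpace X]

/-- If each point of a closed set has, at each scale `t`, at least `N` companions which are
`3 ρ t`-separated, then the dimension is at least `log N / log (1 / ρ)`. -/
theorem le_dimH_of_separated {Γ : Set X} (hΓ : IsClosed Γ) {N : ℕ} (hN : 1 < N) {ρ r : ℝ}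
    (hρ : 0 < ρ) (hρ1 : ρ < 1) (hr : 0 < r) {x₀ : X} (hx₀ : x₀ ∈ Γ)
    (H : ∀ y ∈ Γ, dist y x₀ ≤ r → ∀ t, 0 < t → t ≤ r → ∃ z : Fin N → X, (∀ j, z j ∈ Γ) ∧
      (∀ j, dist y (z j) ≤ (1 - ρ) * t) ∧ ∀ i j, i ≠ j → 3 * ρ * t ≤ dist (z i) (z j))
    {s : NNReal} (hs : 0 < s) (hNs : 1 ≤ N * ρ ^ (s : ℝ)) :
    (s : ℝ≥0∞) ≤ dimH (Γ ∩ Metric.closedBall x₀ r) := by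
  have : NeZero N := ⟨by omega⟩
  have H' : ∀ y t, (y ∈ Γ ∧ dist y x₀ ≤ r ∧ 0 < t ∧ t ≤ r) → ∃ z : Fin N → X, (∀ j, z j ∈ Γ) ∧
      (∀ j, dist y (z j) ≤ (1 - ρ) * t) ∧ ∀ i j, i ≠ j → 3 * ρ * t ≤ dist (z i) (z j) :=
    fun y t h => H y h.1 h.2.1 t h.2.2.1 h.2.2.2
  choose! z hz1 hz2 hz3 using H'
  -- `c a k` is the point reached after `k` choices along the digit sequence `a`; its limit `P a` is
  -- a point of the Cantor set.
  set c : (ℕ → Fin N) → ℕ → X := fun a k => Nat.rec x₀ (fun k y => z y (ρ ^ k * r) (a k)) k with hc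
  have hc0 : ∀ a, c a 0 = x₀ := fun a => rfl
  have hcs : ∀ a k, c a (k + 1) = z (c a k) (ρ ^ k * r) (a k) := fun a k => rfl
  have hsc : ∀ k : ℕ, 0 < ρ ^ k * r ∧ ρ ^ k * r ≤ r := fun k =>
    ⟨by positivity, mul_le_of_le_one_left hr.le (pow_le_one₀ hρ.le hρ1.le)⟩
  -- The balls `B(c a k, ρ ^ k r)` stay inside `B(x₀, r)`, since a step of length `(1 - ρ) t` leaves
  -- room `ρ t`.
  have hinv : ∀ a k, c a k ∈ Γ ∧ dist (c a k) x₀ + ρ ^ k * r ≤ r := by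
    intro a k
    induction k with
    | zero => simp [hc0, hx₀]
    | succ k ih =>
      have hpre : c a k ∈ Γ ∧ dist (c a k) x₀ ≤ r ∧ 0 < ρ ^ k * r ∧ ρ ^ k * r ≤ r :=
        ⟨ih.1, by linarith [(hsc k).1], hsc k⟩
      rw [hcs]
      refine ⟨hz1 _ _ hpre _, ?_⟩
      have h1 := hz2 _ _ hpre (a k)
      have h2 := dist_triangle_left (z (c a k) (ρ ^ k * r) (a k)) x₀ (c a k)
      have h3 : ρ ^ (k + 1) * r = ρ * (ρ ^ k * r) := by ring
      rw [h3]
      linarith [ih.2]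
  have hpre : ∀ a k, c a k ∈ Γ ∧ dist (c a k) x₀ ≤ r ∧ 0 < ρ ^ k * r ∧ ρ ^ k * r ≤ r := fun a k =>
    ⟨(hinv a k).1, by linarith [(hsc k).1, (hinv a k).2], hsc k⟩
  have hstep : ∀ a k, dist (c a k) (c a (k + 1)) ≤ (1 - ρ) * r * ρ ^ k := by
    intro a k
    rw [hcs]
    refine (hz2 _ _ (hpre a k) (a k)).trans_eq (by ring)
  choose P hP using fun a => cauchySeq_tendsto_of_complete
    (cauchySeq_of_le_geometric ρ _ hρ1 (hstep a))
  have hdist : ∀ a k, dist (c a k) (P a) ≤ ρ ^ k * r := by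
    intro a k
    refine (dist_le_of_le_geometric_of_tendsto ρ _ hρ1 (hstep a) (hP a) k).trans_eq ?_
    have : 1 - ρ ≠ 0 := by linarith
    field_simp
  have hPmem : ∀ a, P a ∈ Γ ∩ Metric.closedBall x₀ r := by
    intro a
    refine ⟨hΓ.mem_of_tendsto (hP a) (Eventually.of_forall fun k => (hinv a k).1), ?_⟩
    have := hdist a 0
    rw [hc0] at this
    rw [Metric.mem_closedBall, dist_comm]
    simpa using this
  have hagree : ∀ a b k, (∀ i < k, a i = b i) → c a k = c b k := by
    intro a b k
    induction k with
    | zero => intro _; rfl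
    | succ k ih =>
      intro h
      rw [hcs, hcs, ih fun i hi => h i (by omega), h k (by omega)]
  -- At the first differing digit the gap is `3 ρ t`; each of the two tails consumes at most `ρ t`.
  have hsep : ∀ a b k, (∀ i < k, a i = b i) → a k ≠ b k → ρ ^ (k + 1) * r ≤ dist (P a) (P b) := by
    intro a b k hab hk
    have h1 := hz3 _ _ (hpre a k) _ _ hk
    have h2 := hdist a (k + 1)
    have h3 := hdist b (k + 1)
    rw [hcs] at h2 h3
    rw [← hagree a b k hab] at h3
    have h4 := dist_triangle4 (z (c a k) (ρ ^ k * r) (a k)) (P a) (P b)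
      (z (c a k) (ρ ^ k * r) (b k))
    rw [dist_comm (P b)] at h4
    have h5 : 3 * ρ * (ρ ^ k * r) = 3 * (ρ ^ (k + 1) * r) := by ring
    linarith
  have hfirst : ∀ a b : ℕ → Fin N, a ≠ b → ∃ k, (∀ i < k, a i = b i) ∧ a k ≠ b k := by
    intro a b hab
    have hex := Function.ne_iff.1 hab
    classical
    exact ⟨Nat.find hex, fun i hi => not_not.1 (Nat.find_min hex hi), Nat.find_spec hex⟩
  have hinj : Function.Injective P := by
    intro a b hab
    by_contra hne
    obtain ⟨k, h1, h2⟩ := hfirst a b hne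
    have h3 := hsep a b k h1 h2
    rw [hab, dist_self] at h3
    have : 0 < ρ ^ (k + 1) * r := by positivity
    linarith
  -- Reading the address of a point as a base `N` expansion maps the Cantor set onto `[0, 1]`. The
  -- map is Hölder of exponent `s`, because `N ^ (-k) ≤ ρ ^ (s k)`.
  set f : X → ℝ := fun p => Real.ofDigits (Function.invFun P p) with hf
  have hfP : ∀ a, f (P a) = Real.ofDigits a := fun a => by
    rw [hf]
    simp only [Function.leftInverse_invFun hinj a]
  set C : NNReal := ((ρ * r) ^ (-(s : ℝ))).toNNReal
  have hhold : HolderOnWith C s f (range P) := by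
    rintro _ ⟨a, rfl⟩ _ ⟨b, rfl⟩
    rw [hfP, hfP]
    by_cases hab : a = b
    · rw [hab]; simp
    obtain ⟨k, h1, h2⟩ := hfirst a b hab
    have h3 := hsep a b k h1 h2
    have h4 := Real.abs_ofDigits_sub_ofDigits_le h1
    have hNρ : ((N : ℝ) ^ k)⁻¹ ≤ (ρ ^ (s : ℝ)) ^ k := by
      rw [inv_le_iff_one_le_mul₀ (by positivity), ← mul_pow, mul_comm]
      exact one_le_pow₀ hNs
    have h5 : (ρ ^ (s : ℝ)) ^ k = (ρ * r) ^ (-(s : ℝ)) * (ρ ^ (k + 1) * r) ^ (s : ℝ) := by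
      rw [show ρ ^ (k + 1) * r = (ρ * r) * ρ ^ k by ring,
        Real.mul_rpow (x := ρ * r) (y := ρ ^ k) (by positivity) (by positivity), ← mul_assoc,
        ← Real.rpow_add (by positivity), neg_add_cancel, Real.rpow_zero, one_mul,
        ← Real.rpow_natCast ρ k, ← Real.rpow_mul hρ.le, mul_comm (k : ℝ), Real.rpow_mul hρ.le,
        Real.rpow_natCast]
    have h6 : |Real.ofDigits a - Real.ofDigits b| ≤
        (ρ * r) ^ (-(s : ℝ)) * dist (P a) (P b) ^ (s : ℝ) := by
      refine (h4.trans (hNρ.trans_eq h5)).trans ?_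
      gcongr
    have h7 : (C : ℝ≥0∞) = ENNReal.ofReal ((ρ * r) ^ (-(s : ℝ))) := rfl
    rw [edist_dist, edist_dist, Real.dist_eq, h7, ENNReal.ofReal_rpow_of_nonneg dist_nonneg s.coe_nonneg,
      ← ENNReal.ofReal_mul (by positivity)]
    exact ENNReal.ofReal_le_ofReal h6
  have himg : Icc (0 : ℝ) 1 ⊆ f '' range P := by
    intro x hx
    obtain ⟨a, -, ha⟩ := Real.ofDigits_SurjOn hN hx
    exact ⟨P a, ⟨a, rfl⟩, by rw [hfP, ha]⟩
  have hdim : dimH (Icc (0 : ℝ) 1) = 1 := by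
    rw [Real.dimH_of_nonempty_interior (by rw [interior_Icc]; exact nonempty_Ioo.2 one_pos)]
    simp
  have h8 := (dimH_mono himg).trans (hhold.dimH_image_le hs)
  rw [hdim, ENNReal.le_div_iff_mul_le (Or.inl (by simpa using hs.ne')) (Or.inl ENNReal.coe_ne_top),
    one_mul] at h8
  refine h8.trans (dimH_mono ?_)
  rintro _ ⟨a, rfl⟩
  exact hPmem a

end Cantor

/-! ### Grids in hyperplanes -/

section Grids

variable {n : ℕ}

theorem exists_linearIsometry_range_eq_hyp {k : ℕ} {e : Euc (k + 1)} (he : ‖e‖ = 1) :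
    ∃ Φ : Euc k →ₗᵢ[ℝ] Euc (k + 1), range Φ = hyp e := by
  have he0 : e ≠ 0 := by rintro rfl; simp at he
  have : Fact (Module.finrank ℝ (Euc (k + 1)) = k + 1) := ⟨by simp⟩
  have hfin : Module.finrank ℝ (Submodule.span ℝ {e})ᗮ = k :=
    Submodule.finrank_orthogonal_span_singleton (n := k) he0
  set b := (stdOrthonormalBasis ℝ (Submodule.span ℝ {e})ᗮ).reindex (finCongr hfin)
  refine ⟨(Submodule.span ℝ {e})ᗮ.subtypeₗᵢ.comp b.repr.symm.toLinearIsometry, ?_⟩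
  have h1 : range b.repr.symm = univ := b.repr.symm.surjective.range_eq
  ext z
  constructor
  · rintro ⟨v, rfl⟩
    exact Submodule.mem_orthogonal_singleton_iff_inner_right.1 (b.repr.symm v).2
  · intro hz
    refine ⟨b.repr ⟨z, Submodule.mem_orthogonal_singleton_iff_inner_right.2 hz⟩, ?_⟩
    simp

theorem norm_le_mul_of_forall_abs_le {k : ℕ} {v : Euc k} {c : ℝ} (hc : 0 ≤ c)
    (h : ∀ i, |v i| ≤ c) : ‖v‖ ≤ k * c := by
  refine (pow_le_pow_iff_left₀ (norm_nonneg _) (by positivity) two_ne_zero).1 ?_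
  rw [EuclideanSpace.norm_sq_eq]
  calc ∑ i, ‖v i‖ ^ 2 ≤ ∑ _i : Fin k, c ^ 2 := by
        gcongr with i _
        exact h i
    _ = k * c ^ 2 := by simp
    _ ≤ (k * c) ^ 2 := by
        rw [mul_pow]
        gcongr
        exact_mod_cast Nat.le_self_pow two_ne_zero k

theorem exists_grid_cover (k : ℕ) {m : ℕ} (hm : 0 < m) :
    ∃ S : Finset (Euc k), S.card ≤ (4 * m + 1) ^ k ∧
      ∀ v : Euc k, ‖v‖ ≤ 2 → ∃ g ∈ S, dist v g ≤ k / m := by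
  classical
  have hm' : (0 : ℝ) < m := by exact_mod_cast hm
  refine ⟨Finset.univ.image fun j : Fin k → Fin (4 * m + 1) =>
    (WithLp.toLp 2 fun i => ((j i : ℕ) - 2 * m : ℝ) / m : Euc k), ?_, fun v hv => ?_⟩
  · refine Finset.card_image_le.trans ?_
    simp
  · have hvi : ∀ i, |v i| ≤ 2 := fun i => (PiLp.norm_apply_le v i).trans hv
    have hnn : ∀ i, 0 ≤ m * v i + 2 * m := fun i => by nlinarith [(abs_le.1 (hvi i)).1]
    have hlt : ∀ i, ⌊m * v i + 2 * m⌋₊ < 4 * m + 1 := by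
      intro i
      rw [Nat.floor_lt (hnn i)]
      push_cast
      nlinarith [(abs_le.1 (hvi i)).2]
    refine ⟨_, Finset.mem_image.2 ⟨fun i => ⟨⌊m * v i + 2 * m⌋₊, hlt i⟩, Finset.mem_univ _, rfl⟩, ?_⟩
    rw [dist_eq_norm, div_eq_mul_inv]
    refine norm_le_mul_of_forall_abs_le (by positivity) fun i => ?_
    have h1 := Nat.floor_le (hnn i)
    have h2 := Nat.lt_floor_add_one (m * v i + 2 * m)
    have h3 : (v - WithLp.toLp 2 fun i => ((⌊m * v i + 2 * m⌋₊ : ℕ) - 2 * m : ℝ) / m : Euc k) i =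
        (m * v i + 2 * m - ⌊m * v i + 2 * m⌋₊) * (m : ℝ)⁻¹ := by
      simp only [PiLp.sub_apply]
      field_simp
      ring
    rw [h3, abs_mul, abs_of_nonneg (by linarith), abs_of_pos (by positivity)]
    exact mul_le_of_le_one_left (by positivity) (by linarith)

theorem exists_grid_separated (k : ℕ) {m : ℕ} (hm : 0 < m) :
    ∃ g : Fin (m ^ k) → Euc k, (∀ j, ‖g j‖ ≤ 1 / 2) ∧
      ∀ i j, i ≠ j → 1 / (2 * ((k : ℝ) + 1) * m) ≤ dist (g i) (g j) := by
  have hm' : (0 : ℝ) < m := by exact_mod_cast hm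
  have hcard : Fintype.card (Fin (m ^ k)) = Fintype.card (Fin k → Fin m) := by simp
  obtain ⟨E⟩ := Fintype.card_eq.1 hcard
  refine ⟨fun j => WithLp.toLp 2 fun i => ((E j i : ℕ) : ℝ) / (2 * ((k : ℝ) + 1) * m),
    fun j => ?_, fun i j hij => ?_⟩
  · refine (norm_le_mul_of_forall_abs_le (c := 1 / (2 * ((k : ℝ) + 1))) (by positivity)
      fun i => ?_).trans ?_
    · simp only
      rw [abs_of_nonneg (by positivity), div_le_div_iff₀ (by positivity) (by positivity)]
      have : ((E j i : ℕ) : ℝ) ≤ m := by exact_mod_cast (E j i).2.le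
      have : (0 : ℝ) < 2 * ((k : ℝ) + 1) := by positivity
      nlinarith
    · rw [mul_one_div, div_le_div_iff₀ (by positivity) (by positivity)]
      linarith
  · obtain ⟨l, hl⟩ := Function.ne_iff.1 (E.injective.ne hij)
    rw [dist_eq_norm]
    refine le_trans ?_ (PiLp.norm_apply_le _ l)
    simp only [PiLp.sub_apply]
    rw [← sub_div, Real.norm_eq_abs, abs_div, abs_of_pos (show 0 < 2 * ((k : ℝ) + 1) * m by positivity)]
    gcongr
    have h1 : ((E i l : ℕ) : ℤ) - (E j l : ℕ) ≠ 0 := by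
      intro h
      apply hl
      ext
      omega
    have h2 := Int.one_le_abs h1
    exact_mod_cast h2

theorem FlatSet.exists_cover {k m : ℕ} (hm : 0 < m) {A : Set (Euc (k + 1))}
    (h : FlatSet A (1 / m)) :
    ∃ S : Finset (Euc (k + 1)), S.card ≤ (4 * m + 1) ^ k ∧
      ∀ a ∈ A, ‖a‖ ≤ 1 → ∃ g ∈ S, dist a g ≤ ((k : ℝ) + 1) / m := by
  classical
  have hm' : (1 : ℝ) ≤ m := by exact_mod_cast hm
  obtain ⟨e, he, hN⟩ := h
  obtain ⟨Φ, hΦ⟩ := exists_linearIsometry_range_eq_hyp he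
  obtain ⟨S, hS, hcov⟩ := exists_grid_cover k hm
  refine ⟨S.image Φ, Finset.card_image_le.trans hS, fun a ha hn => ?_⟩
  obtain ⟨b, hb, hd⟩ := hN.1 a ha hn
  rw [← hΦ] at hb
  obtain ⟨v, rfl⟩ := hb
  have hv : ‖v‖ ≤ 2 := by
    have h1 := norm_le_add_of_dist_le hn hd
    rw [Φ.norm_map] at h1
    have : 1 / (m : ℝ) ≤ 1 := by rw [div_le_one (by positivity)]; exact hm'
    linarith
  obtain ⟨g, hg, hvg⟩ := hcov v hv
  refine ⟨Φ g, Finset.mem_image_of_mem _ hg, (dist_triangle _ (Φ v) _).trans ?_⟩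
  rw [Φ.dist_map, add_div]
  linarith

theorem FlatSet.exists_separated {k m : ℕ} (hm : 0 < m) {A : Set (Euc (k + 1))}
    (h : FlatSet A (1 / (16 * ((k : ℝ) + 1) * m))) :
    ∃ z : Fin (m ^ k) → Euc (k + 1), (∀ j, z j ∈ A) ∧
      (∀ j, ‖z j‖ ≤ 1 - 1 / (16 * ((k : ℝ) + 1) * m)) ∧
      ∀ i j, i ≠ j → 3 * (1 / (16 * ((k : ℝ) + 1) * m)) ≤ dist (z i) (z j) := by
  have hm' : (1 : ℝ) ≤ m := by exact_mod_cast hm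
  obtain ⟨e, he, hN⟩ := h
  obtain ⟨Φ, hΦ⟩ := exists_linearIsometry_range_eq_hyp he
  obtain ⟨g, hg, hsep⟩ := exists_grid_separated k hm
  set ρ : ℝ := 1 / (16 * ((k : ℝ) + 1) * m) with hρ
  -- The grid spacing is `8 ρ`; moving both endpoints by the flatness error `ρ` leaves `6 ρ`, more
  -- than the required `3 ρ`.
  have hρ8 : 1 / (2 * ((k : ℝ) + 1) * m) = 8 * ρ := by
    rw [hρ]; field_simp; norm_num
  have hρ1 : ρ ≤ 1 / 16 := by
    rw [hρ, div_le_div_iff₀ (by positivity) (by positivity)]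
    have : (0 : ℝ) ≤ k := by positivity
    nlinarith
  have hρ0 : 0 < ρ := by positivity
  choose z hz hd using fun j => hN.2 (Φ (g j)) (by rw [← hΦ]; exact ⟨_, rfl⟩)
    (by rw [Φ.norm_map]; linarith [hg j])
  refine ⟨z, hz, fun j => ?_, fun i j hij => ?_⟩
  · have := norm_le_add_of_dist_le ((Φ.norm_map (g j)).le.trans (hg j)) (hd j)
    linarith
  · have h1 := hsep i j hij
    rw [hρ8, ← Φ.dist_map] at h1
    have h2 := dist_triangle4 (Φ (g i)) (z i) (z j) (Φ (g j))
    have h3 := hd i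
    have h4 := hd j
    rw [dist_comm] at h4
    linarith

end Grids

end

noncomputable section
open MvPolynomial

/-! ### The Hausdorff dimension of the set of flat points -/

/-- The product is of order `m ^ (k - s)`, which tends to zero because `s > k`. -/
theorem exists_nat_cover_ratio {k : ℕ} {s : ℝ} (hs : (k : ℝ) < s) :
    ∃ m : ℕ, 0 < m ∧ 2 * (((k : ℝ) + 1) / m) < 1 ∧
      ((4 * m + 1) ^ k : ℕ) * (2 * (((k : ℝ) + 1) / m)) ^ s < 1 := by
  have h1 : Tendsto (fun m : ℕ => 5 ^ k * (2 * ((k : ℝ) + 1)) ^ s * (m : ℝ) ^ (-(s - k)))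
      atTop (𝓝 0) := by
    have := ((tendsto_rpow_neg_atTop (sub_pos.2 hs)).comp tendsto_natCast_atTop_atTop).const_mul
      (5 ^ k * (2 * ((k : ℝ) + 1)) ^ s)
    simpa [Function.comp_def] using this
  have h2 : Tendsto (fun m : ℕ => 2 * (((k : ℝ) + 1) / m)) atTop (𝓝 0) := by
    simpa using (tendsto_const_div_atTop_nhds_zero_nat ((k : ℝ) + 1)).const_mul 2
  obtain ⟨m, hm1, hm2, hm0⟩ := ((h1.eventually_lt_const one_pos).and
    ((h2.eventually_lt_const one_pos).and (eventually_gt_atTop 0))).exists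
  refine ⟨m, hm0, hm2, lt_of_le_of_lt ?_ hm1⟩
  have hm' : (1 : ℝ) ≤ m := by exact_mod_cast hm0
  have e1 : (((4 * m + 1) ^ k : ℕ) : ℝ) ≤ 5 ^ k * (m : ℝ) ^ k := by
    rw [← mul_pow]
    push_cast
    gcongr
    linarith
  have e2 : (2 * (((k : ℝ) + 1) / m)) ^ s = (2 * ((k : ℝ) + 1)) ^ s * (m : ℝ) ^ (-s) := by
    rw [Real.rpow_neg (by positivity), ← mul_div_assoc, Real.div_rpow (by positivity)
      (by positivity), div_eq_mul_inv]
  have e3 : (m : ℝ) ^ (-(s - k)) = (m : ℝ) ^ k * (m : ℝ) ^ (-s) := by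
    rw [← Real.rpow_natCast, ← Real.rpow_add (by positivity)]
    congr 1
    ring
  rw [e2, e3]
  calc _ ≤ 5 ^ k * (m : ℝ) ^ k * ((2 * ((k : ℝ) + 1)) ^ s * (m : ℝ) ^ (-s)) := by gcongr
    _ = _ := by ring

theorem exists_nat_separated_ratio {k : ℕ} {s : ℝ} (hs : s < k) :
    ∃ m : ℕ, 1 < m ∧ 1 ≤ ((m ^ k : ℕ) : ℝ) * (1 / (16 * ((k : ℝ) + 1) * m)) ^ s := by
  have h1 : Tendsto (fun m : ℕ => (1 / (16 * ((k : ℝ) + 1))) ^ s * (m : ℝ) ^ (k - s))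
      atTop atTop :=
    ((tendsto_rpow_atTop (sub_pos.2 hs)).comp tendsto_natCast_atTop_atTop).const_mul_atTop
      (by positivity)
  obtain ⟨m, hm1, hm2⟩ := ((h1.eventually_ge_atTop 1).and (eventually_gt_atTop 1)).exists
  refine ⟨m, hm2, hm1.trans_eq ?_⟩
  have hm' : (0 : ℝ) < m := by positivity
  rw [← div_div 1 (16 * ((k : ℝ) + 1)), Real.div_rpow (by positivity) hm'.le, Real.rpow_sub hm', Real.rpow_natCast]
  push_cast
  ring

/-- If the dimension exceeded some `s > k`, it would do so in every neighbourhood of some flat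
point; uniform flatness there gives a self-similar covering that forbids it. -/
theorem dimH_flatPoints_le {k d : ℕ} {Γ : Set (Euc (k + 1))} (hΓ : IsClosed Γ)
    (happrox : LocallyWellApproximated (harmonicZeroSets (k + 1) d) Γ) :
    dimH (flatPoints Γ) ≤ k := by
  classical
  by_contra! hlt
  obtain ⟨s, hks, hs⟩ := ENNReal.lt_iff_exists_nnreal_btwn.1 hlt
  obtain ⟨x, hx, hloc⟩ := exists_mem_nhdsWithin_lt_dimH_of_lt_dimH hs
  obtain ⟨R, hR, hflat⟩ := exists_uniformlyFlatNear_of_mem_flatPoints hΓ happrox hx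
  have hks' : (k : ℝ) < s := by exact_mod_cast hks
  obtain ⟨m, hm0, hm1, hm2⟩ := exists_nat_cover_ratio hks'
  have hm' : (0 : ℝ) < m := by exact_mod_cast hm0
  obtain ⟨t₀, ht₀, H⟩ := hflat (1 / m) (by positivity)
  set K := Γ ∩ Metric.closedBall x R with hK
  have hxK : x ∈ K := ⟨hx.1, Metric.mem_closedBall_self hR.le⟩
  set q : ℝ := ((k : ℝ) + 1) / m with hq
  have hdim : dimH (K ∩ Metric.closedBall x t₀) ≤ s := by
    refine dimH_inter_closedBall_le_of_cover (ρ := 2 * q) (by positivity) hm1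
      (fun y hy t ht htt => ?_) hm2 hxK ht₀ le_rfl
    obtain ⟨S, hS, hcov⟩ := (H y hy.1 hy.2 t ht htt).exists_cover hm0
    -- The grid centres need not lie in `K`. Each useful one is replaced by a point of `K` within `q
    -- t`, which doubles the ratio to `2 q`.
    set good : Euc (k + 1) → Prop := fun g => (K ∩ Metric.closedBall (y + t • g) (q * t)).Nonempty
    have hchoice : ∀ g, ∃ w, good g → w ∈ K ∩ Metric.closedBall (y + t • g) (q * t) := by
      intro g
      by_cases hg : good g
      · exact ⟨hg.some, fun _ => hg.some_mem⟩
      · exact ⟨y, fun h => absurd h hg⟩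
    choose w hw using hchoice
    refine ⟨(S.filter good).image w, Finset.card_image_le.trans
      ((Finset.card_filter_le _ _).trans hS), ?_, ?_⟩
    · intro v hv
      obtain ⟨g, hg, rfl⟩ := Finset.mem_image.1 (Finset.mem_coe.1 hv)
      exact (hw g (Finset.mem_filter.1 hg).2).1
    · rintro a ⟨haK, hay⟩
      have hay' : y + t • t⁻¹ • (a - y) = a := add_smul_inv_smul_sub ht.ne'
      obtain ⟨g, hg, hd⟩ := hcov (t⁻¹ • (a - y)) (by rw [mem_zoom, hay']; exact haK.1) (by
        rw [norm_smul, norm_inv, Real.norm_of_nonneg ht.le, ← dist_eq_norm, inv_mul_le_iff₀ ht,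
          mul_one]
        exact hay)
      rw [dist_comm, dist_inv_smul_sub ht, div_le_iff₀ ht, dist_comm] at hd
      have hgood : good g := ⟨a, haK, hd⟩
      refine mem_iUnion₂.2 ⟨w g, Finset.mem_image_of_mem _ (Finset.mem_filter.2 ⟨hg, hgood⟩), ?_⟩
      have h1 : dist (w g) (y + t • g) ≤ q * t := (hw g hgood).2
      have h2 : dist a (y + t • g) ≤ q * t := hd
      have := dist_triangle_right a (w g) (y + t • g)
      rw [Metric.mem_closedBall]
      linarith
  refine (hloc (flatPoints Γ ∩ Metric.closedBall x (min R t₀))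
    (inter_mem_nhdsWithin _ (Metric.closedBall_mem_nhds x (lt_min hR ht₀)))).not_ge ?_
  refine (dimH_mono ?_).trans hdim
  intro z hz
  exact ⟨⟨hz.1.1, Metric.closedBall_subset_closedBall (min_le_left _ _) hz.2⟩,
    Metric.closedBall_subset_closedBall (min_le_right _ _) hz.2⟩

theorem le_dimH_flatPoints {k d : ℕ} (hk : 1 ≤ k) {Γ : Set (Euc (k + 1))} (hΓ : IsClosed Γ)
    (happrox : LocallyWellApproximated (harmonicZeroSets (k + 1) d) Γ) (hne : Γ.Nonempty) :
    (k : ℝ≥0∞) ≤ dimH (flatPoints Γ) := by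
  refine ENNReal.le_of_forall_pos_nnreal_lt fun s hs hsk => ?_
  obtain ⟨x, hx, R, hR, hflat⟩ := exists_mem_uniformlyFlatNear hΓ happrox hne
  have hsk' : (s : ℝ) < k := by exact_mod_cast hsk
  obtain ⟨m, hm1, hm⟩ := exists_nat_separated_ratio hsk'
  have hm' : (1 : ℝ) < m := by exact_mod_cast hm1
  set ρ : ℝ := 1 / (16 * ((k : ℝ) + 1) * m) with hρ
  have hρ0 : 0 < ρ := by positivity
  have hρ1 : ρ < 1 := by
    rw [hρ, div_lt_one (by positivity)]
    have : (0 : ℝ) ≤ k := by positivity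
    nlinarith
  obtain ⟨t₀, ht₀, H⟩ := hflat ρ hρ0
  have h1 := le_dimH_of_separated (r := min R t₀) hΓ (Nat.one_lt_pow (by omega) hm1) hρ0 hρ1
    (lt_min hR ht₀) hx (fun y hy hyx t ht htt => by
      obtain ⟨z, hz, hz1, hz2⟩ := (H y hy (hyx.trans (min_le_left _ _)) t ht
        (htt.trans (min_le_right _ _))).exists_separated (by omega)
      refine ⟨fun j => y + t • z j, hz, fun j => ?_, fun i j hij => ?_⟩
      · rw [dist_self_add_right, norm_smul, Real.norm_of_nonneg ht.le, mul_comm]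
        have := hz1 j
        gcongr
      · rw [dist_add_left, dist_smul₀, Real.norm_of_nonneg ht.le, mul_comm]
        have := hz2 i j hij
        gcongr) hs hm
  refine h1.trans (dimH_mono fun z hz => ?_)
  exact UniformlyFlatNear.mem_flatPoints ⟨hR, hflat⟩ hz.1
    ((Metric.mem_closedBall.1 hz.2).trans (min_le_left _ _))

variable {n : ℕ}

/-! ### Blow-ups -/

theorem near_of_hausdorffEDist_lt {A B : Set (Euc n)} {s ε : ℝ}
    (h : Metric.hausdorffEDist (A ∩ Metric.closedBall 0 s) (B ∩ Metric.closedBall 0 s) <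
      ENNReal.ofReal ε) : Near A B s ε := by
  have hε : 0 < ε := by
    by_contra hle
    rw [ENNReal.ofReal_of_nonpos (not_lt.1 hle)] at h
    exact not_lt_zero h
  have key : ∀ a b : Euc n, edist a b < ENNReal.ofReal ε → dist a b ≤ ε := by
    intro a b hab
    rw [edist_dist, ENNReal.ofReal_lt_ofReal_iff hε] at hab
    exact hab.le
  refine ⟨fun a ha hn => ?_, fun a ha hn => ?_⟩
  · obtain ⟨b, hb, hab⟩ := Metric.exists_edist_lt_of_hausdorffEDist_lt
      (show a ∈ A ∩ Metric.closedBall 0 s from ⟨ha, by simpa using hn⟩) h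
    exact ⟨b, hb.1, key _ _ hab⟩
  · rw [Metric.hausdorffEDist_comm] at h
    obtain ⟨b, hb, hab⟩ := Metric.exists_edist_lt_of_hausdorffEDist_lt
      (show a ∈ B ∩ Metric.closedBall 0 s from ⟨ha, by simpa using hn⟩) h
    exact ⟨b, hb.1, key _ _ hab⟩

theorem image_inv_smul_sub_eq_zoom (A : Set (Euc n)) (x : Euc n) {r : ℝ} (hr : r ≠ 0) :
    (fun y => r⁻¹ • (y - x)) '' A = zoom A x r := by
  ext z
  constructor
  · rintro ⟨y, hy, rfl⟩
    rwa [mem_zoom, add_smul_inv_smul_sub hr]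
  · intro hz
    refine ⟨x + r • z, hz, ?_⟩
    simp [smul_smul, inv_mul_cancel₀ hr]

theorem IsBlowup.exists_near {Γ B : Set (Euc n)} {x : Euc n} (h : IsBlowup Γ x B)
    {r₀ ε : ℝ} (hr₀ : 0 < r₀) (hε : 0 < ε) :
    ∃ r, 0 < r ∧ r ≤ r₀ ∧ Near (zoom Γ x r) B 1 ε := by
  obtain ⟨_, _, r, hr, hr0, hlim⟩ := h
  obtain ⟨i, hi1, hi2⟩ := (((hlim 1 one_pos).eventually_lt_const
    (show 0 < ENNReal.ofReal ε by simpa using hε)).and (hr0.eventually_le_const hr₀)).exists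
  rw [image_inv_smul_sub_eq_zoom _ _ (hr i).ne'] at hi1
  exact ⟨r i, hr i, hi2, near_of_hausdorffEDist_lt hi1⟩

theorem zoom_polyZeroSet_of_isHomogeneous {k : ℕ} {p : MvPolynomial (Fin n) ℝ}
    (hp : p.IsHomogeneous k) {s : ℝ} (hs : s ≠ 0) :
    zoom (polyZeroSet p) 0 s = polyZeroSet p := by
  ext x
  have h1 := eval_smul_of_isHomogeneous hp s (fun i => x i)
  have h2 : ev p (0 + s • x) = s ^ k * ev p x := by
    rw [zero_add]
    exact h1
  rw [mem_zoom, mem_polyZeroSet, mem_polyZeroSet, h2]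
  simp [hs]

/-- Comparing `B` with a flat rescaling of `Γ` controls only the ball of radius `1 / 2`; invariance
of `B` under zooming by `1 / 2` restores the unit ball. -/
theorem flatSet_blowup {Γ B : Set (Euc n)} {x : Euc n} {ρ : ℝ} (hx : UniformlyFlatNear Γ x ρ)
    (h : IsBlowup Γ x B) (hcone : zoom B 0 (1 / 2) = B) {ε : ℝ} (hε : 0 < ε) :
    FlatSet B ε := by
  set η := min (ε / 4) (1 / 4) with hη
  have hη0 : 0 < η := by positivity
  have e1 : η ≤ ε / 4 := min_le_left _ _
  have e2 : η ≤ 1 / 4 := min_le_right _ _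
  obtain ⟨t₀, ht₀, H⟩ := hx.2 η hη0
  obtain ⟨r, hr, hrt, hN⟩ := h.exists_near ht₀ hη0
  obtain ⟨e, he, hN'⟩ := H x h.1 (by simpa using hx.1.le) r hr hrt
  have h1 : Near B (hyp e) (1 / 2) (η + η) :=
    hN.symm.trans hN' (by norm_num) (by norm_num) (by linarith) (by linarith)
  have h2 := h1.zoom 0 (s := 1 / 2) (R' := 1) (by norm_num) (by simp)
  rw [hcone, zoom_hyp (zero_mem_hyp e) (by norm_num)] at h2
  refine ⟨e, he, h2.mono le_rfl ?_⟩
  rw [div_le_iff₀ (by norm_num)]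
  linarith

/-- A flat zero set has a dominating linear part, which a nonzero homogeneous polynomial has only in
degree 1. -/
theorem blowup_mem_hyperplanes {Γ B : Set (Euc n)} {x : Euc n} {ρ : ℝ} {k : ℕ} (hk : 1 ≤ k)
    (hx : UniformlyFlatNear Γ x ρ) (h : IsBlowup Γ x B) (hB : IsHomogeneousHarmonicZeroSet k B) :
    B ∈ hyperplanes n := by
  obtain ⟨p, hp0, hp, hh, rfl⟩ := hB
  obtain ⟨δ, hδ, c, hc, H⟩ := exists_linear_dominates n k
  have hz : ev p 0 = 0 := by
    rw [ev_zero_eq]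
    exact hp.coeff_eq_zero (by simp; omega)
  have hdom := H p hp0 hh hp.totalDegree_le hz
    (flatSet_blowup hx h (zoom_polyZeroSet_of_isHomogeneous hp (by norm_num)) hδ)
  have hk1 : k = 1 := by
    by_contra hne
    apply hp0
    have hlin : ∀ i, coeff (Finsupp.single i 1) p = 0 := fun i =>
      hp.coeff_eq_zero (by simpa using Ne.symm hne)
    ext α
    have h1 := hdom α
    simp only [hlin, abs_zero, Finset.sum_const_zero] at h1
    have h2 : |coeff α p| ≤ 0 := by
      by_contra hlt
      have := mul_pos hc (not_le.1 hlt)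
      linarith
    simpa using h2
  subst hk1
  obtain ⟨e, he, heq⟩ := exists_polyZeroSet_eq_hyp hp hp0
  rw [heq]
  exact hyp_mem_hyperplanes he

/-- A hyperplane blow-up makes `Γ` `δ`-flat at some arbitrarily small scale, and one such scale
suffices by propagation. -/
theorem mem_flatPoints_of_linear_blowup {d : ℕ} {Γ B : Set (Euc n)} (hΓ : IsClosed Γ)
    (happrox : LocallyWellApproximated (harmonicZeroSets n d) Γ) {x : Euc n}
    (h : IsBlowup Γ x B) (hB : IsHomogeneousHarmonicZeroSet 1 B) : x ∈ flatPoints Γ := by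
  obtain ⟨p, hp0, hp, hh, rfl⟩ := hB
  obtain ⟨e, he, heq⟩ := exists_polyZeroSet_eq_hyp hp hp0
  obtain ⟨δ, hδ, H⟩ := exists_uniformlyFlatNear hΓ happrox
  obtain ⟨r₀, hr₀, H'⟩ := H x
  obtain ⟨r, hr, hrr, hN⟩ := h.exists_near hr₀ hδ
  rw [heq] at hN
  obtain ⟨ρ, hρ⟩ := H' x r (by simp) hr hrr ⟨e, he, hN⟩
  exact hρ.mem_flatPoints h.1 (by simpa using hρ.1.le)

/-! ### Topology and flatness of the set of flat points -/

theorem exists_isOpen_flatPoints_eq {d : ℕ} {Γ : Set (Euc n)} (hΓ : IsClosed Γ)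
    (happrox : LocallyWellApproximated (harmonicZeroSets n d) Γ) :
    ∃ U : Set (Euc n), IsOpen U ∧ flatPoints Γ = Γ ∩ U := by
  choose! ρ hρ using fun x (hx : x ∈ flatPoints Γ) =>
    exists_uniformlyFlatNear_of_mem_flatPoints hΓ happrox hx
  refine ⟨⋃ x ∈ flatPoints Γ, Metric.ball x (ρ x), isOpen_biUnion fun x _ => Metric.isOpen_ball, ?_⟩
  ext y
  constructor
  · intro hy
    exact ⟨hy.1, mem_iUnion₂.2 ⟨y, hy, Metric.mem_ball_self (hρ y hy).1⟩⟩
  · rintro ⟨hy, hyU⟩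
    obtain ⟨x, hx, hyx⟩ := mem_iUnion₂.1 hyU
    exact (hρ x hx).mem_flatPoints hy (Metric.mem_ball.1 hyx).le

theorem locallyReifenbergFlatVanishing_flatPoints {d : ℕ} {Γ : Set (Euc n)} (hΓ : IsClosed Γ)
    (happrox : LocallyWellApproximated (harmonicZeroSets n d) Γ) :
    LocallyReifenbergFlatVanishing (flatPoints Γ) := by
  intro δ hδ K hK hKΓ
  set ε := min (δ / 2) 1 with hε
  have hε0 : 0 < ε := by positivity
  have hεδ : 2 * ε ≤ δ := by
    have := min_le_left (δ / 2) 1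
    linarith
  have key : ∃ r₀ : ℝ, 0 < r₀ ∧ ∀ y ∈ K, y ∈ Γ → ∀ r : ℝ, 0 < r → r ≤ r₀ →
      localCloseness (hyperplanes n) (flatPoints Γ) y r ≤ ENNReal.ofReal δ := by
    refine hK.induction_on (p := fun s => ∃ r₀ : ℝ, 0 < r₀ ∧ ∀ y ∈ s, y ∈ Γ → ∀ r : ℝ, 0 < r →
      r ≤ r₀ → localCloseness (hyperplanes n) (flatPoints Γ) y r ≤ ENNReal.ofReal δ) ?_ ?_ ?_ ?_
    · exact ⟨1, one_pos, by simp⟩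
    · rintro s t hst ⟨r₀, h0, h1⟩
      exact ⟨r₀, h0, fun y hy => h1 y (hst hy)⟩
    · rintro s t ⟨r₀, h0, h1⟩ ⟨r₁, h2, h3⟩
      refine ⟨min r₀ r₁, lt_min h0 h2, ?_⟩
      rintro y (hy | hy) hyΓ r hr hrr
      · exact h1 y hy hyΓ r hr (hrr.trans (min_le_left _ _))
      · exact h3 y hy hyΓ r hr (hrr.trans (min_le_right _ _))
    · intro x hx
      obtain ⟨ρ, hρ⟩ := exists_uniformlyFlatNear_of_mem_flatPoints hΓ happrox (hKΓ hx)
      have hρ0 := hρ.1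
      obtain ⟨t₀, ht₀, H⟩ := hρ.2 ε hε0
      refine ⟨Metric.ball x (ρ / 2), mem_nhdsWithin_of_mem_nhds
        (Metric.ball_mem_nhds x (half_pos hρ0)), min (ρ / 2) t₀, lt_min (half_pos hρ0) ht₀,
        fun y hy hyΓ r hr hrr => ?_⟩
      rw [Metric.mem_ball] at hy
      -- All of `Γ` near `x` consists of flat points, so in small balls the two sets coincide and
      -- the flatness of `Γ` transfers.
      have hsame : flatPoints Γ ∩ Metric.closedBall y r = Γ ∩ Metric.closedBall y r := by
        refine Subset.antisymm (inter_subset_inter_left _ fun z hz => hz.1) ?_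
        rintro z ⟨hz, hzy⟩
        refine ⟨hρ.mem_flatPoints hz ?_, hzy⟩
        have h1 := dist_triangle z y x
        have h2 := hrr.trans (min_le_left _ _)
        rw [Metric.mem_closedBall] at hzy
        linarith
      have h1 := localCloseness_le_of_flatSet hr hε0.le (min_le_right _ _)
        (H y hyΓ (by linarith) r hr (hrr.trans (min_le_right _ _)))
      unfold localCloseness at h1 ⊢
      rw [hsame]
      exact h1.trans (ENNReal.ofReal_le_ofReal hεδ)
  obtain ⟨r₀, h0, h1⟩ := key
  exact ⟨r₀, h0, fun y hy => h1 y hy (hKΓ hy).1⟩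

end

/-! ### Assembly of the theorem -/

theorem theorem5p10 (n d : ℕ) (hn : 2 ≤ n) (hd : 1 ≤ d) (Γ : Set (Euc n))
    (hne : Γ.Nonempty) (hclosed : IsClosed Γ)
    (happrox : LocallyWellApproximated (harmonicZeroSets n d) Γ)
    (hblow : ∀ x ∈ Γ, ∀ B : Set (Euc n), IsBlowup Γ x B →
      ∃ k : ℕ, 1 ≤ k ∧ IsHomogeneousHarmonicZeroSet k B) :
    ∃ Γ₁ Γs : Set (Euc n),
      Γ = Γ₁ ∪ Γs ∧ Disjoint Γ₁ Γs ∧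
      Γ₁ = flatPoints Γ ∧
      (∀ x ∈ Γ₁, ∀ B : Set (Euc n), IsBlowup Γ x B → B ∈ hyperplanes n) ∧
      (∀ x ∈ Γs, ∀ B : Set (Euc n), IsBlowup Γ x B →
        ∃ k : ℕ, 2 ≤ k ∧ IsHomogeneousHarmonicZeroSet k B) ∧
      (∃ U : Set (Euc n), IsOpen U ∧ Γ₁ = Γ ∩ U) ∧
      LocallyReifenbergFlatVanishing Γ₁ ∧
      dimH Γ₁ = ((n - 1 : ℕ) : ℝ≥0∞) := by
  refine ⟨flatPoints Γ, Γ \ flatPoints Γ, ?_, disjoint_sdiff_right, rfl, ?_, ?_,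
    exists_isOpen_flatPoints_eq hclosed happrox,
    locallyReifenbergFlatVanishing_flatPoints hclosed happrox, ?_⟩
  · exact (union_sdiff_cancel fun x hx => hx.1).symm
  · intro x hx B hB
    obtain ⟨k, hk, hBk⟩ := hblow x hx.1 B hB
    obtain ⟨ρ, hρ⟩ := exists_uniformlyFlatNear_of_mem_flatPoints hclosed happrox hx
    exact blowup_mem_hyperplanes hk hρ hB hBk
  · intro x hx B hB
    obtain ⟨k, hk, hBk⟩ := hblow x hx.1 B hB
    refine ⟨k, ?_, hBk⟩
    by_contra hlt
    obtain rfl : k = 1 := by omega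
    exact hx.2 (mem_flatPoints_of_linear_blowup hclosed happrox hB hBk)
  · obtain ⟨k, rfl⟩ : ∃ k, n = k + 1 := ⟨n - 1, by omega⟩
    rw [Nat.add_sub_cancel]
    exact le_antisymm (dimH_flatPoints_le hclosed happrox)
      (le_dimH_flatPoints (by omega) hclosed happrox hne)
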